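/- Let $n$ be a positive integer and let $\beta,\sigma,\nu\in\mathbb{C}$ with $\sigma-\nu\notin\mathbb{Z}$, $\beta-n+1\notin\{0,-1,-2,\dots\}$ and $\beta+\sigma\notin\{0,-1,-2,\dots\}$. Write $(a)_k=a(a+1)\cdots(a+k-1)$ for the Pochhammer symbol. Let ${}_3F_2$ denote the principal branch of the generalized hypergeometric function, that is, the analytic continuation of its power series from $|z|<1$ to $\mathbb{C}\setminus[1,\infty)$; powers have their principal values, and $1/\Gamma$ is taken as the entire function that vanishes at $0,-1,-2,\dots$. Then for every $z\in\mathbb{C}$ with $|1-z|<1$, $z\neq1$ and $|\arg(1-z)|<\pi$, $$ \begin{aligned} &\frac{\Gamma(\beta)\,(\nu-n+1)_{n-1}}{\Gamma(\beta+\sigma)\,(n-1)!}\,z^{n-1}\, {}_3F_2\!\left(\beta,\nu,1;\ \beta+\sigma,n;\ z\right)\\ &\quad=\frac{(-1)^n\pi\csc(\pi(\sigma-\nu))}{\Gamma(1+\nu-n)\,\Gamma(\sigma-\nu+n)}\, (1-z)^{\sigma+n-\nu-1}\, {}_2F_1\!\left(\sigma,\beta+\sigma-\nu;\ \sigma-\nu+n;\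 1-z\right)\\ &\qquad-\frac{(-1)^n\pi\csc(\pi(\sigma-\nu))\,\Gamma(\beta-n+1)} {\Gamma(\sigma)\,\Gamma(\beta+\sigma-\nu)\,\Gamma(2-n-\sigma+\nu)}\, {}_2F_1\!\left(1+\nu-n,\beta-n+1;\ 2-n-\sigma+\nu;\ 1-z\right)\\ &\qquad-\sum_{l=0}^{n-2}\frac{1}{l!}\left[\sum_{k=l}^{n-2} \frac{(\nu-n+1)_k\,\Gamma(k-n+\beta+1)}{\Gamma(k-n+\beta+\sigma+1)\,(k-l)!}\right](z-1)^l , \end{aligned} $$ where an empty sum is $0$. (For $\nu\ne n$, $(\nu-n+1)_{n-1}=(\nu-n)_n/(\nu-n)$.) -/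

import Mathlib

/-- The `k`-th coefficient `(a₁)ₖ (a₂)ₖ (a₃)ₖ / ((b₁)ₖ (b₂)ₖ k!)` of the hypergeometric series
`₃F₂(a₁, a₂, a₃; b₁, b₂; z)`, where `(a)ₖ = a (a + 1) ⋯ (a + k - 1)`. -/
noncomputable def threeFTwoCoeff (a₁ a₂ a₃ b₁ b₂ : ℂ) (k : ℕ) : ℂ :=
  (ascPochhammer ℂ k).eval a₁ * (ascPochhammer ℂ k).eval a₂ * (ascPochhammer ℂ k).eval a₃ /
    ((ascPochhammer ℂ k).eval b₁ * (ascPochhammer ℂ k).eval b₂ * (k.factorial : ℂ))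

/-- `w` is the value at `z` of the analytic continuation of the series `₃F₂` along the segment
from `0` to `z`: some holomorphic function on an open set that is star-shaped about `0` and
contains `z` is the sum of the series near `0` and takes the value `w` at `z`. Since
`ℂ \ [1, ∞)` is star-shaped about `0`, for `z` in that set this is the value of the principal
branch of `₃F₂`, the one with `|arg (1 - z)| < π`. -/
def IsThreeFTwoValue (a₁ a₂ a₃ b₁ b₂ z w : ℂ) : Prop :=
  ∃ (U : Set ℂ) (F : ℂ → ℂ), IsOpen U ∧ StarConvex ℝ 0 U ∧ z ∈ U ∧ DifferentiableOn ℂ F U ∧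
    (∀ᶠ s in nhds (0 : ℂ), HasSum (fun k : ℕ => threeFTwoCoeff a₁ a₂ a₃ b₁ b₂ k * s ^ k) (F s)) ∧
    F z = w

/-- The continued value does not depend on the choices made. -/
theorem IsThreeFTwoValue.unique {a₁ a₂ a₃ b₁ b₂ z w w' : ℂ}
    (h : IsThreeFTwoValue a₁ a₂ a₃ b₁ b₂ z w) (h' : IsThreeFTwoValue a₁ a₂ a₃ b₁ b₂ z w') :
    w = w' := by
  obtain ⟨U, F, hU, sU, zU, dF, sF, rfl⟩ := h
  obtain ⟨V, G, hV, sV, zV, dG, sG, rfl⟩ := h'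
  have hUV : IsOpen (U ∩ V) := hU.inter hV
  have hs : StarConvex ℝ 0 (U ∩ V) := sU.inter sV
  have h0 : (0 : ℂ) ∈ U ∩ V := hs.mem ⟨z, zU, zV⟩
  have hc : IsPreconnected (U ∩ V) := (hs.isPathConnected h0).isConnected.isPreconnected
  have hF : AnalyticOnNhd ℂ F (U ∩ V) := (dF.mono Set.inter_subset_left).analyticOnNhd hUV
  have hG : AnalyticOnNhd ℂ G (U ∩ V) := (dG.mono Set.inter_subset_right).analyticOnNhd hUV
  have he : F =ᶠ[nhds 0] G := by
    filter_upwards [sF, sG] with s h1 h2 using h1.unique h2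
  exact hF.eqOn_of_preconnected_of_eventuallyEq hG hc h0 he ⟨zU, zV⟩

open Classical in
/-- The generalized hypergeometric function `₃F₂(a₁, a₂, a₃; b₁, b₂; z)` (principal branch): the
sum of the series for `|z| < 1`, continued analytically to `ℂ \ [1, ∞)`. -/
noncomputable def threeFTwo (a₁ a₂ a₃ b₁ b₂ z : ℂ) : ℂ :=
  if h : ∃ w, IsThreeFTwoValue a₁ a₂ a₃ b₁ b₂ z w then h.choose else 0

theorem IsThreeFTwoValue.threeFTwo_eq {a₁ a₂ a₃ b₁ b₂ z w : ℂ}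
    (h : IsThreeFTwoValue a₁ a₂ a₃ b₁ b₂ z w) : threeFTwo a₁ a₂ a₃ b₁ b₂ z = w := by
  have he : ∃ w, IsThreeFTwoValue a₁ a₂ a₃ b₁ b₂ z w := ⟨w, h⟩
  rw [threeFTwo, dif_pos he]
  exact he.choose_spec.unique h

/-! Put N = n - 1, a = ν - N, b = β - N, c = β + σ - N, so that c - a - b = σ - ν + N is not an
integer. The prefactor times z^N times the ₃F₂ series is Γ(b) times the tail, from index N on, of
the regularized Gauss series F = ₂F₁(a, b; c; z)/Γ(c) (`prefactor_mul_threeFTwoCoeff`). The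
connection formula for F between 0 and 1 (`regularizedGaussHGFun_connection`) produces the two ₂F₁
terms; the N removed terms, re-expanded in powers of z - 1, produce the finite sum
(`sum_mul_pow_eq_sum_sub_one_pow`). The identity holds on the lens |z| < 1, |1 - z| < 1 and is
continued to the disc around 1 cut along [1, 2).

For the connection formula, a weighted Wronskian is constant, so every solution on the lens is a
combination of the regular and the singular solution at 1 (`exists_eq_add`). The coefficient of the
regular one is the limit of F at 1 when Re(c - a - b) > 0, that is, Gauss's summation theorem,
proved by letting c tend to infinity through c + N. Euler's transformation exchanges the two local
solutions and so gives the other coefficient. The operator c + z d/dz, which lowers c by one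
throughout, removes the conditions on real parts. -/

namespace HypergeometricConnection

open Complex Filter Topology Set

/-! ### Power series on the unit disc. -/

/-- `f` is the sum of `∑ u m * z ^ m` on the open unit disc. -/
def HasUnitSeries (u : ℕ → ℂ) (f : ℂ → ℂ) : Prop :=
  ∀ z : ℂ, ‖z‖ < 1 → HasSum (fun m => u m * z ^ m) (f z)

/-- The coefficients of `z * ∑ u m * z ^ m`. -/
def shift (u : ℕ → ℂ) : ℕ → ℂ
  | 0 => 0
  | m + 1 => u m

namespace HasUnitSeries

variable {u v : ℕ → ℂ} {f g : ℂ → ℂ}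

theorem add (hf : HasUnitSeries u f) (hg : HasUnitSeries v g) :
    HasUnitSeries (fun m => u m + v m) (fun z => f z + g z) := fun z hz => by
  simpa only [add_mul] using (hf z hz).add (hg z hz)

theorem const_mul (k : ℂ) (hf : HasUnitSeries u f) :
    HasUnitSeries (fun m => k * u m) (fun z => k * f z) := fun z hz => by
  simpa only [mul_assoc] using (hf z hz).mul_left k

theorem unique (hf : HasUnitSeries u f) (hg : HasUnitSeries v g) (h : ∀ m, u m = v m)
    {z : ℂ} (hz : ‖z‖ < 1) : f z = g z := by
  obtain rfl : u = v := funext h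
  exact (hf z hz).unique (hg z hz)

theorem id_mul (hf : HasUnitSeries u f) :
    HasUnitSeries (shift u) (fun z => z * f z) := fun z hz => by
  rw [← hasSum_nat_add_iff' 1]
  simpa [shift, pow_succ, mul_assoc, mul_comm, mul_left_comm] using (hf z hz).mul_left z

theorem hasDerivAt (hf : HasUnitSeries u f) {z : ℂ} (hz : ‖z‖ < 1) :
    HasDerivAt f (deriv f z) z ∧ HasSum (fun m : ℕ => ((m : ℂ) + 1) * u (m + 1) * z ^ m) (deriv f z) := by
  obtain ⟨r, hzr, hr1⟩ := exists_between hz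
  have hr0 : 0 ≤ r := (norm_nonneg z).trans hzr.le
  have hsum : Summable fun m => ‖u m‖ * r ^ m := by
    have := (hf r (by simpa [abs_of_nonneg hr0] using hr1)).summable.norm
    simpa [abs_of_nonneg hr0] using this
  have hdiff : ∀ m : ℕ, DifferentiableOn ℂ (fun w : ℂ => u m * w ^ m) (Metric.ball 0 r) :=
    fun m => by fun_prop
  have hle : ∀ (m : ℕ) (w : ℂ), w ∈ Metric.ball (0 : ℂ) r → ‖u m * w ^ m‖ ≤ ‖u m‖ * r ^ m := by
    intro m w hw
    rw [norm_mul, norm_pow]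
    have : ‖w‖ ≤ r := (mem_ball_zero_iff.1 hw).le
    gcongr
  have hzm : z ∈ Metric.ball (0 : ℂ) r := mem_ball_zero_iff.2 hzr
  have hnh : Metric.ball (0 : ℂ) r ∈ 𝓝 z := Metric.isOpen_ball.mem_nhds hzm
  have heq : (fun w : ℂ => ∑' m, u m * w ^ m) =ᶠ[𝓝 z] f := by
    filter_upwards [hnh] with w hw
    exact (hf w ((mem_ball_zero_iff.1 hw).trans hr1)).tsum_eq
  have hD := differentiableOn_tsum_of_summable_norm hsum hdiff Metric.isOpen_ball hle
  have h1 := hasSum_deriv_of_summable_norm hsum hdiff Metric.isOpen_ball hle hzm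
  rw [heq.deriv_eq] at h1
  refine ⟨((hD.differentiableAt hnh).congr_of_eventuallyEq heq.symm).hasDerivAt, ?_⟩
  rw [← hasSum_nat_add_iff' 1] at h1
  simpa [mul_comm, mul_left_comm, mul_assoc] using h1

theorem derivative (hf : HasUnitSeries u f) :
    HasUnitSeries (fun m : ℕ => ((m : ℂ) + 1) * u (m + 1)) (deriv f) :=
  fun _ hz => (hf.hasDerivAt hz).2

theorem differentiableOn (hf : HasUnitSeries u f) : DifferentiableOn ℂ f (Metric.ball 0 1) :=
  fun _ hz => (hf.hasDerivAt (mem_ball_zero_iff.1 hz)).1.differentiableAt.differentiableWithinAt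

theorem continuousAt_zero (hf : HasUnitSeries u f) : ContinuousAt f 0 :=
  (hf.hasDerivAt (by simp)).1.continuousAt

theorem apply_zero (hf : HasUnitSeries u f) : f 0 = u 0 := by
  have h := hf 0 (by simp)
  have h' : HasSum (fun m => u m * (0 : ℂ) ^ m) (u 0) := by
    convert hasSum_single (f := fun m => u m * (0 : ℂ) ^ m) 0 (fun m hm => by simp [hm]) using 1
    simp
  exact h.unique h'

end HasUnitSeries

/-! ### The regularized Gauss series and its differential equation. -/

/-- The coefficients of the regularized Gauss series `₂F₁(a, b; c; z) / Γ(c)`. -/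
noncomputable def gaussCoeff (a b c : ℂ) (m : ℕ) : ℂ :=
  (ascPochhammer ℂ m).eval a * (ascPochhammer ℂ m).eval b * (Gamma (c + m))⁻¹ / (m.factorial : ℂ)

theorem gaussCoeff_zero (a b c : ℂ) : gaussCoeff a b c 0 = (Gamma c)⁻¹ := by
  simp [gaussCoeff]

theorem hasUnitSeries_regularizedGaussHGFun (a b c : ℂ) :
    HasUnitSeries (gaussCoeff a b c) (regularizedGaussHGFun a b c) := fun z hz => by
  have h := (regularizedGaussHGFunSeries a b c).hasSum (x := z) (by
    refine Metric.eball_subset_eball (radius_regularizedGaussHGFunSeries_ge_one a b c) ?_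
    simpa [← ofReal_norm] using hz)
  simp only [FormalMultilinearSeries.apply_eq_pow_smul_coeff, coeff_regularizedGaussHGFunSeries,
    smul_eq_mul] at h
  refine h.congr_fun fun m => ?_
  simp only [gaussCoeff]
  ring

/-- No condition on c is needed: 1/Γ(s) = s/Γ(s + 1) also holds at the poles, where `Gamma` and its
inverse take the value 0. -/
theorem gaussCoeff_succ (a b c : ℂ) (m : ℕ) :
    ((m : ℂ) + 1) * (c + m) * gaussCoeff a b c (m + 1) = (a + m) * (b + m) * gaussCoeff a b c m := by
  have h1 := one_div_Gamma_eq_self_mul_one_div_Gamma_add_one (c + m)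
  have hm : (m : ℂ) + 1 ≠ 0 := Nat.cast_add_one_ne_zero m
  have hf : (m.factorial : ℂ) ≠ 0 := Nat.cast_ne_zero.2 m.factorial_ne_zero
  simp only [gaussCoeff, ascPochhammer_succ_eval, Nat.factorial_succ, Nat.cast_mul, Nat.cast_add,
    Nat.cast_one, ← add_assoc]
  rw [h1]
  field_simp

theorem gaussCoeff_lower (a b c : ℂ) (m : ℕ) :
    gaussCoeff a b c m = (c + m) * gaussCoeff a b (c + 1) m := by
  have h1 := one_div_Gamma_eq_self_mul_one_div_Gamma_add_one (c + m)
  simp only [gaussCoeff, h1, add_right_comm c 1]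
  ring

/-- The Gauss hypergeometric equation. -/
theorem regularizedGaussHGFun_ode (a b c : ℂ) {z : ℂ} (hz : ‖z‖ < 1) :
    z * (1 - z) * deriv (deriv (regularizedGaussHGFun a b c)) z
      + (c - (a + b + 1) * z) * deriv (regularizedGaussHGFun a b c) z
      - a * b * regularizedGaussHGFun a b c z = 0 := by
  have h0 := hasUnitSeries_regularizedGaussHGFun a b c
  have h1 := h0.derivative
  have h2 := h1.derivative
  have hl := h2.id_mul.add (h1.const_mul c)
  have hr := (h2.id_mul.id_mul.add (h1.id_mul.const_mul (a + b + 1))).add (h0.const_mul (a * b))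
  have := hl.unique hr (fun m => ?_) hz
  · linear_combination this
  -- The cases m = 0 and m = 1 are separate because `shift`, applied up to twice, inserts zeros
  -- there.
  · rcases m with _ | _ | m
    · have := gaussCoeff_succ a b c 0
      simp only [shift]; push_cast at this ⊢
      linear_combination this
    · have := gaussCoeff_succ a b c 1
      simp only [shift]; push_cast at this ⊢
      linear_combination this
    · have := gaussCoeff_succ a b c (m + 2)
      simp only [shift]; push_cast at this ⊢
      linear_combination this

theorem regularizedGaussHGFun_lower (a b c : ℂ) {z : ℂ} (hz : ‖z‖ < 1) :
    c * regularizedGaussHGFun a b (c + 1) z + z * deriv (regularizedGaussHGFun a b (c + 1)) z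
      = regularizedGaussHGFun a b c z := by
  have h0 := hasUnitSeries_regularizedGaussHGFun a b (c + 1)
  refine ((h0.const_mul c).add h0.derivative.id_mul).unique
    (hasUnitSeries_regularizedGaussHGFun a b c) (fun m => ?_) hz
  have := gaussCoeff_lower a b c m
  cases m with
  | zero => simp only [shift]; push_cast at this; linear_combination -this
  | succ m => simp only [shift]; push_cast at this; linear_combination -this

/-! ### The lens and limits at its corners 0 and 1. -/

/-- The common part of the discs of convergence around `0` and `1`. -/
def lens : Set ℂ := Metric.ball 0 1 ∩ Metric.ball 1 1

theorem mem_lens {z : ℂ} : z ∈ lens ↔ ‖z‖ < 1 ∧ ‖1 - z‖ < 1 := by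
  simp [lens, Complex.dist_eq, norm_sub_rev z 1]

theorem isOpen_lens : IsOpen lens := Metric.isOpen_ball.inter Metric.isOpen_ball

theorem isPreconnected_lens : IsPreconnected lens :=
  ((convex_ball 0 1).inter (convex_ball 1 1)).isPreconnected

theorem one_sub_mem_lens {z : ℂ} (hz : z ∈ lens) : 1 - z ∈ lens := by
  rw [mem_lens] at hz ⊢
  simpa using hz.symm

theorem re_pos_of_norm_one_sub_lt {z : ℂ} (hz : ‖1 - z‖ < 1) : 0 < z.re := by
  have h := (re_le_norm (1 - z)).trans_lt hz
  simpa using h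

theorem mem_slitPlane_of_mem_lens {z : ℂ} (hz : z ∈ lens) : z ∈ slitPlane :=
  Or.inl (re_pos_of_norm_one_sub_lt (mem_lens.1 hz).2)

theorem ofReal_mem_lens {t : ℝ} (h0 : 0 < t) (h1 : t < 1) : (t : ℂ) ∈ lens := by
  rw [mem_lens]
  norm_cast
  rw [Real.norm_of_nonneg h0.le, Real.norm_of_nonneg (by linarith)]
  exact ⟨h1, by linarith⟩

instance neBot_nhdsWithin_lens_one : (𝓝[lens] (1 : ℂ)).NeBot := by
  have h : Tendsto (fun t : ℝ => (t : ℂ)) (𝓝[<] 1) (𝓝[lens] (1 : ℂ)) := by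
    refine tendsto_nhdsWithin_iff.2 ⟨?_, ?_⟩
    · have := (continuous_ofReal.tendsto (1 : ℝ)).mono_left (nhdsWithin_le_nhds (s := Iio 1))
      simpa using this
    · filter_upwards [Ioo_mem_nhdsLT (zero_lt_one' ℝ)] with t ht using ofReal_mem_lens ht.1 ht.2
  exact h.neBot

instance neBot_nhdsWithin_lens_zero : (𝓝[lens] (0 : ℂ)).NeBot := by
  have h : Tendsto (fun t : ℝ => (t : ℂ)) (𝓝[>] 0) (𝓝[lens] (0 : ℂ)) := by
    refine tendsto_nhdsWithin_iff.2 ⟨?_, ?_⟩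
    · have := (continuous_ofReal.tendsto (0 : ℝ)).mono_left (nhdsWithin_le_nhds (s := Ioi 0))
      simpa using this
    · filter_upwards [Ioo_mem_nhdsGT (zero_lt_one' ℝ)] with t ht using ofReal_mem_lens ht.1 ht.2
  exact h.neBot

theorem tendsto_one_sub_lens : Tendsto (fun z : ℂ => 1 - z) (𝓝[lens] 1) (𝓝[lens] 0) := by
  refine tendsto_nhdsWithin_iff.2 ⟨?_, eventually_nhdsWithin_of_forall fun z => one_sub_mem_lens⟩
  have : Tendsto (fun z : ℂ => 1 - z) (𝓝 1) (𝓝 (1 - 1)) := by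
    exact (continuous_const.sub continuous_id).tendsto 1
  simpa using this.mono_left nhdsWithin_le_nhds

theorem tendsto_cpow_lens_zero {s : ℂ} (hs : 0 < s.re) :
    Tendsto (fun z : ℂ => z ^ s) (𝓝[lens] 0) (𝓝 0) := by
  have h := (continuousAt_cpow_const_of_re_pos (z := 0) (w := s) (Or.inl le_rfl) hs).tendsto
  have hs0 : s ≠ 0 := by
    rintro rfl
    simp at hs
  rw [zero_cpow hs0] at h
  exact h.mono_left nhdsWithin_le_nhds

/-! ### Solutions on the lens and their Wronskian. -/

/-- `u` solves the hypergeometric equation with parameters `a, b, c` on the lens, with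
derivative `u'`. -/
def IsGaussSol (a b c : ℂ) (u u' : ℂ → ℂ) : Prop :=
  ∃ u'' : ℂ → ℂ, ∀ z ∈ lens, HasDerivAt u (u' z) z ∧ HasDerivAt u' (u'' z) z ∧
    z * (1 - z) * u'' z + (c - (a + b + 1) * z) * u' z - a * b * u z = 0

theorem isGaussSol_regularizedGaussHGFun (a b c : ℂ) :
    IsGaussSol a b c (regularizedGaussHGFun a b c) (deriv (regularizedGaussHGFun a b c)) := by
  refine ⟨deriv (deriv (regularizedGaussHGFun a b c)), fun z hz => ?_⟩
  have hz' := (mem_lens.1 hz).1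
  have h := hasUnitSeries_regularizedGaussHGFun a b c
  exact ⟨(h.hasDerivAt hz').1, (h.derivative.hasDerivAt hz').1, regularizedGaussHGFun_ode a b c hz'⟩

theorem IsGaussSol.reflect {a b c : ℂ} {u u' : ℂ → ℂ} (h : IsGaussSol a b c u u') :
    IsGaussSol a b (a + b + 1 - c) (fun z => u (1 - z)) (fun z => -u' (1 - z)) := by
  obtain ⟨u'', h⟩ := h
  refine ⟨fun z => u'' (1 - z), fun z hz => ?_⟩
  obtain ⟨h1, h2, h3⟩ := h (1 - z) (one_sub_mem_lens hz)
  have hd : HasDerivAt (fun z : ℂ => 1 - z) (-1) z := by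
    simpa using (hasDerivAt_id z).const_sub 1
  refine ⟨?_, ?_, ?_⟩
  · simpa [Function.comp_def] using h1.comp z hd
  · simpa [Function.comp_def] using! (h2.comp z hd).neg
  · linear_combination h3

theorem hasDerivAt_one_sub_cpow (s : ℂ) {z : ℂ} (hz : 1 - z ∈ slitPlane) :
    HasDerivAt (fun z : ℂ => (1 - z) ^ s) (-s * ((1 - z) ^ s / (1 - z))) z := by
  have hd : HasDerivAt (fun z : ℂ => 1 - z) (-1) z := by
    simpa using (hasDerivAt_id z).const_sub 1
  have h := hd.cpow_const (c := s) hz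
  rw [cpow_sub _ _ (slitPlane_ne_zero hz), cpow_one] at h
  convert h using 1
  ring

theorem IsGaussSol.euler {a b c : ℂ} {u u' : ℂ → ℂ} (h : IsGaussSol (c - a) (c - b) c u u') :
    IsGaussSol a b c (fun z => (1 - z) ^ (c - a - b) * u z)
      (fun z => (1 - z) ^ (c - a - b) * (u' z - (c - a - b) * u z / (1 - z))) := by
  obtain ⟨u'', h⟩ := h
  set s := c - a - b with hs
  refine ⟨fun z => (1 - z) ^ s * (u'' z - 2 * s * u' z / (1 - z)
    + s * (s - 1) * u z / (1 - z) ^ 2), fun z hz => ?_⟩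
  obtain ⟨h1, h2, h3⟩ := h z hz
  have hsl := mem_slitPlane_of_mem_lens (one_sub_mem_lens hz)
  have hne := slitPlane_ne_zero hsl
  have hp := hasDerivAt_one_sub_cpow s hsl
  have hd : HasDerivAt (fun z : ℂ => 1 - z) (-1) z := by
    simpa using (hasDerivAt_id z).const_sub 1
  refine ⟨?_, ?_, ?_⟩
  · refine (hp.mul h1).congr_deriv ?_
    field_simp
    ring
  · refine (hp.mul (h2.sub ((h1.const_mul s).div hd hne))).congr_deriv ?_
    simp only [Pi.sub_apply, Pi.div_apply]
    field_simp
    ring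
  · have : (1 - z) * (z * (1 - z) * u'' z + (c - (c - a + (c - b) + 1) * z) * u' z
        - (c - a) * (c - b) * u z) = 0 := by rw [h3, mul_zero]
    field_simp
    rw [hs]
    linear_combination (1 - z) ^ (c - a - b) * this

/-- The Wronskian of `u` and `v` times the weight that makes it constant for solutions of the
hypergeometric equation. -/
noncomputable def gaussWronskian (a b c : ℂ) (u u' v v' : ℂ → ℂ) (z : ℂ) : ℂ :=
  z ^ c * (1 - z) ^ (a + b + 1 - c) * (u z * v' z - u' z * v z)

/-- Abel's identity: the weight has logarithmic derivative (c - (a + b + 1)z)/(z(1 - z)), which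
cancels that of the Wronskian. -/
theorem IsGaussSol.exists_gaussWronskian_eq {a b c : ℂ} {u u' v v' : ℂ → ℂ}
    (hu : IsGaussSol a b c u u') (hv : IsGaussSol a b c v v') :
    ∃ k, ∀ z ∈ lens, gaussWronskian a b c u u' v v' z = k := by
  obtain ⟨u'', hu⟩ := hu
  obtain ⟨v'', hv⟩ := hv
  have key : ∀ z ∈ lens, HasDerivAt (gaussWronskian a b c u u' v v') 0 z := by
    intro z hz
    obtain ⟨h1, h2, h3⟩ := hu z hz
    obtain ⟨k1, k2, k3⟩ := hv z hz
    have hsl := mem_slitPlane_of_mem_lens (one_sub_mem_lens hz)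
    have hsl' := mem_slitPlane_of_mem_lens hz
    have hne := slitPlane_ne_zero hsl
    have hne' := slitPlane_ne_zero hsl'
    have hc := (hasDerivAt_id z).cpow_const (c := c) hsl'
    rw [id_eq, cpow_sub _ _ hne', cpow_one] at hc
    have hp := hasDerivAt_one_sub_cpow (a + b + 1 - c) hsl
    refine ((hc.mul hp).mul ((h1.mul k2).sub (h2.mul k1))).congr_deriv ?_
    simp only [Pi.sub_apply, Pi.mul_apply, id_eq]
    field_simp
    linear_combination (z ^ c * (1 - z) ^ (a + b + 1 - c)) * (u z * k3 - v z * h3)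
  exact isOpen_lens.exists_is_const_of_deriv_eq_zero isPreconnected_lens
    (fun z hz => (key z hz).differentiableAt.differentiableWithinAt) fun z hz => (key z hz).deriv

/-- The three-term identity for 2 × 2 determinants; with constant Wronskians it becomes a linear
relation between three solutions. -/
theorem gaussWronskian_cycle (a b c : ℂ) (u u' v v' w w' : ℂ → ℂ) (z : ℂ) :
    gaussWronskian a b c v v' w w' z * u z = gaussWronskian a b c u u' w w' z * v z
      + gaussWronskian a b c v v' u u' z * w z := by
  simp only [gaussWronskian]
  ring

/-! ### The two local solutions at 1. -/

/-- The solution of the hypergeometric equation that is regular at `1`. -/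
noncomputable def regularAtOne (a b c z : ℂ) : ℂ :=
  regularizedGaussHGFun a b (a + b + 1 - c) (1 - z)

/-- The derivative of `regularAtOne a b c`. -/
noncomputable def regularAtOneDeriv (a b c z : ℂ) : ℂ :=
  -deriv (regularizedGaussHGFun a b (a + b + 1 - c)) (1 - z)

/-- The solution of the hypergeometric equation with exponent `c - a - b` at `1`. -/
noncomputable def singularAtOne (a b c z : ℂ) : ℂ :=
  (1 - z) ^ (c - a - b) * regularizedGaussHGFun (c - a) (c - b) (c - a - b + 1) (1 - z)

/-- The derivative of `singularAtOne a b c`. -/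
noncomputable def singularAtOneDeriv (a b c z : ℂ) : ℂ :=
  (1 - z) ^ (c - a - b) *
    (-deriv (regularizedGaussHGFun (c - a) (c - b) (c - a - b + 1)) (1 - z)
      - (c - a - b) * regularizedGaussHGFun (c - a) (c - b) (c - a - b + 1) (1 - z) / (1 - z))

theorem isGaussSol_regularAtOne (a b c : ℂ) :
    IsGaussSol a b c (regularAtOne a b c) (regularAtOneDeriv a b c) := by
  have h := (isGaussSol_regularizedGaussHGFun a b (a + b + 1 - c)).reflect
  rw [sub_sub_cancel] at h
  exact h

theorem isGaussSol_singularAtOne (a b c : ℂ) :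
    IsGaussSol a b c (singularAtOne a b c) (singularAtOneDeriv a b c) := by
  have h := (isGaussSol_regularizedGaussHGFun (c - a) (c - b) (c - a - b + 1)).reflect
  rw [show c - a + (c - b) + 1 - (c - a - b + 1) = c by ring] at h
  exact h.euler

theorem tendsto_reflect_lens {u : ℕ → ℂ} {f : ℂ → ℂ} (hf : HasUnitSeries u f) :
    Tendsto (fun z => f (1 - z)) (𝓝[lens] 1) (𝓝 (u 0)) := by
  have h := hf.continuousAt_zero.tendsto
  rw [hf.apply_zero] at h
  exact h.comp (tendsto_one_sub_lens.mono_right nhdsWithin_le_nhds)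

theorem tendsto_regularAtOne (a b c : ℂ) :
    Tendsto (regularAtOne a b c) (𝓝[lens] 1) (𝓝 (Gamma (a + b + 1 - c))⁻¹) := by
  have h := tendsto_reflect_lens (hasUnitSeries_regularizedGaussHGFun a b (a + b + 1 - c))
  rwa [gaussCoeff_zero] at h

theorem tendsto_singularAtOne {a b c : ℂ} (h : 0 < (c - a - b).re) :
    Tendsto (singularAtOne a b c) (𝓝[lens] 1) (𝓝 0) := by
  have h1 := tendsto_reflect_lens
    (hasUnitSeries_regularizedGaussHGFun (c - a) (c - b) (c - a - b + 1))
  have h2 := (tendsto_cpow_lens_zero h).comp tendsto_one_sub_lens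
  simpa [singularAtOne, Function.comp_def] using! h2.mul h1

/-- The constant is read off in the limit z → 1. -/
theorem gaussWronskian_regularAtOne_singularAtOne (a b c : ℂ) {z : ℂ} (hz : z ∈ lens) :
    gaussWronskian a b c (regularAtOne a b c) (regularAtOneDeriv a b c)
      (singularAtOne a b c) (singularAtOneDeriv a b c) z
      = -(c - a - b) * (Gamma (a + b + 1 - c))⁻¹ * (Gamma (c - a - b + 1))⁻¹ := by
  obtain ⟨k, hk⟩ := (isGaussSol_regularAtOne a b c).exists_gaussWronskian_eq
    (isGaussSol_singularAtOne a b c)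
  rw [hk z hz]
  have s1 := hasUnitSeries_regularizedGaussHGFun a b (a + b + 1 - c)
  have s2 := hasUnitSeries_regularizedGaussHGFun (c - a) (c - b) (c - a - b + 1)
  have l0 := tendsto_reflect_lens s1
  have l1 := tendsto_reflect_lens s1.derivative
  have m0 := tendsto_reflect_lens s2
  have m1 := tendsto_reflect_lens s2.derivative
  have lw : Tendsto (fun z : ℂ => 1 - z) (𝓝[lens] 1) (𝓝 0) :=
    tendsto_one_sub_lens.mono_right nhdsWithin_le_nhds
  have lc : Tendsto (fun z : ℂ => z ^ c) (𝓝[lens] 1) (𝓝 1) := by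
    have : ContinuousAt (fun z : ℂ => z ^ c) 1 := (hasDerivAt_id (1 : ℂ)).cpow_const (c := c)
      (by simp) |>.continuousAt
    simpa [ContinuousAt] using this.mono_left (nhdsWithin_le_nhds (s := lens))
  have hlim := lc.mul ((l0.mul ((lw.mul m1).neg.sub (m0.const_mul (c - a - b)))).add
    ((l1.mul lw).mul m0))
  refine (tendsto_nhds_unique (f := fun _ : ℂ => k) (l := 𝓝[lens] 1) tendsto_const_nhds
    (hlim.congr' ?_)).trans ?_
  · filter_upwards [self_mem_nhdsWithin] with z hz
    have hne : (1 - z) ≠ 0 := slitPlane_ne_zero (mem_slitPlane_of_mem_lens (one_sub_mem_lens hz))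
    rw [← hk z hz]
    simp only [gaussWronskian, regularAtOne, regularAtOneDeriv, singularAtOne, singularAtOneDeriv]
    -- The exponents of the weight and of the singular solution add up to 1; this factor 1 - z
    -- absorbs the pole in the derivative of the singular solution.
    have hp : (1 - z) ^ (a + b + 1 - c) * (1 - z) ^ (c - a - b) = 1 - z := by
      rw [← cpow_add _ _ hne]
      ring_nf
      simp
    generalize regularizedGaussHGFun (c - a) (c - b) (c - a - b + 1) (1 - z) = h0
    generalize deriv (regularizedGaussHGFun (c - a) (c - b) (c - a - b + 1)) (1 - z) = h1
    generalize regularizedGaussHGFun a b (a + b + 1 - c) (1 - z) = g0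
    generalize deriv (regularizedGaussHGFun a b (a + b + 1 - c)) (1 - z) = g1
    field_simp
    linear_combination (-z ^ c * (g0 * (-(1 - z) * h1 - (c - a - b) * h0) + g1 * (1 - z) * h0)) * hp
  · rw [gaussCoeff_zero, gaussCoeff_zero]
    ring

/-- For s = c - a - b this is the Wronskian of the two local solutions; by the reflection formula it
is -sin(πs)/π. -/
theorem inv_Gamma_mul_ne_zero {s : ℂ} (hs : ∀ m : ℤ, s ≠ m) :
    -s * (Gamma (1 - s))⁻¹ * (Gamma (s + 1))⁻¹ ≠ 0 := by
  refine mul_ne_zero (mul_ne_zero (neg_ne_zero.2 (by simpa using hs 0)) (inv_ne_zero ?_))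
    (inv_ne_zero ?_)
  · refine Gamma_ne_zero fun m hm => hs (m + 1) ?_
    push_cast
    linear_combination -hm
  · refine Gamma_ne_zero fun m hm => hs (-m - 1) ?_
    push_cast
    linear_combination hm

/-- Cramer's rule, with constant Wronskians as determinants. -/
theorem exists_eq_add {a b c : ℂ} (hs : ∀ m : ℤ, c - a - b ≠ m) {u u' : ℂ → ℂ}
    (hu : IsGaussSol a b c u u') :
    ∃ A B : ℂ, ∀ z ∈ lens, u z = A * regularAtOne a b c z + B * singularAtOne a b c z := by
  obtain ⟨k, hk⟩ := hu.exists_gaussWronskian_eq (isGaussSol_singularAtOne a b c)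
  obtain ⟨l, hl⟩ := (isGaussSol_regularAtOne a b c).exists_gaussWronskian_eq hu
  have h0 := inv_Gamma_mul_ne_zero hs
  rw [show 1 - (c - a - b) = a + b + 1 - c by ring] at h0
  set d := -(c - a - b) * (Gamma (a + b + 1 - c))⁻¹ * (Gamma (c - a - b + 1))⁻¹ with hd
  refine ⟨k / d, l / d, fun z hz => ?_⟩
  have h := gaussWronskian_cycle a b c u u' (regularAtOne a b c) (regularAtOneDeriv a b c)
    (singularAtOne a b c) (singularAtOneDeriv a b c) z
  rw [gaussWronskian_regularAtOne_singularAtOne a b c hz, ← hd, hk z hz, hl z hz] at h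
  field_simp
  linear_combination h

theorem tendsto_of_eq_add {a b c A B : ℂ} {u : ℂ → ℂ} (hre : 0 < (c - a - b).re)
    (h : ∀ z ∈ lens, u z = A * regularAtOne a b c z + B * singularAtOne a b c z) :
    Tendsto u (𝓝[lens] 1) (𝓝 (A * (Gamma (a + b + 1 - c))⁻¹)) := by
  have := ((tendsto_regularAtOne a b c).const_mul A).add ((tendsto_singularAtOne hre).const_mul B)
  rw [mul_zero, add_zero] at this
  refine this.congr' ?_
  filter_upwards [self_mem_nhdsWithin] with z hz using (h z hz).symm

/-! ### The operator c + z d/dz on the solutions at 1. -/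

theorem regularAtOne_lower (a b c : ℂ) {z : ℂ} (hz : z ∈ lens) :
    c * regularAtOne a b (c + 1) z + z * regularAtOneDeriv a b (c + 1) z
      = -((c - a) * (c - b)) * regularAtOne a b c z := by
  have hz' := (mem_lens.1 (one_sub_mem_lens hz)).1
  have hd : a + b + 1 - c = a + b + 1 - (c + 1) + 1 := by ring
  have h0 := hasUnitSeries_regularizedGaussHGFun a b (a + b + 1 - (c + 1))
  have h1 := (hasUnitSeries_regularizedGaussHGFun a b (a + b + 1 - c)).const_mul
    (-((c - a) * (c - b)))
  have := (((h0.const_mul c).add (h0.derivative.const_mul (-1))).add h0.derivative.id_mul).unique h1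
    (fun m => ?_) hz'
  · simp only [regularAtOne, regularAtOneDeriv]
    linear_combination this
  · have e1 := gaussCoeff_succ a b (a + b + 1 - (c + 1)) m
    have e2 := gaussCoeff_lower a b (a + b + 1 - (c + 1)) (m + 1)
    have e3 := gaussCoeff_lower a b (a + b + 1 - (c + 1)) m
    have e4 := gaussCoeff_succ a b (a + b + 1 - c) m
    rw [← hd] at e2 e3
    cases m with
    | zero =>
      simp only [shift]
      push_cast at *
      rw [e2, e3]
      linear_combination -e4
    | succ m =>
      simp only [shift]
      push_cast at *
      rw [e2, e3]
      linear_combination -e4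

theorem singularAtOne_lower (a b c : ℂ) {z : ℂ} (hz : z ∈ lens) :
    c * singularAtOne a b (c + 1) z + z * singularAtOneDeriv a b (c + 1) z
      = -singularAtOne a b c z := by
  have hz' := (mem_lens.1 (one_sub_mem_lens hz)).1
  have hne : 1 - z ≠ 0 := slitPlane_ne_zero (mem_slitPlane_of_mem_lens (one_sub_mem_lens hz))
  have h0 := hasUnitSeries_regularizedGaussHGFun (c + 1 - a) (c + 1 - b) (c + 1 - a - b + 1)
  have h1 := (hasUnitSeries_regularizedGaussHGFun (c - a) (c - b) (c - a - b + 1)).const_mul (-1)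
  have hp : (1 - z) ^ (c + 1 - a - b) = (1 - z) ^ (c - a - b) * (1 - z) := by
    rw [show c + 1 - a - b = c - a - b + 1 by ring, cpow_add _ _ hne, cpow_one]
  have := (((((h0.id_mul.const_mul c).add (h0.const_mul (-(c + 1 - a - b)))).add
    (h0.id_mul.const_mul (c + 1 - a - b))).add (h0.derivative.id_mul.const_mul (-1))).add
    h0.derivative.id_mul.id_mul).unique h1 (fun m => ?_) hz'
  · simp only [singularAtOne, singularAtOneDeriv, hp]
    field_simp
    linear_combination (1 - z) ^ (c - a - b) * this
  · cases m with
    | zero =>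
      simp only [shift, gaussCoeff_zero]
      have := one_div_Gamma_eq_self_mul_one_div_Gamma_add_one (c + 1 - a - b)
      rw [show c - a - b + 1 = c + 1 - a - b by ring, this]
      ring
    | succ m =>
      have e1 := gaussCoeff_succ (c + 1 - a) (c + 1 - b) (c + 1 - a - b + 1) m
      -- The coefficient form of the derivative formula, which raises all three parameters by one.
      have e2 : ((m : ℂ) + 1) * gaussCoeff (c - a) (c - b) (c - a - b + 1) (m + 1)
          = (c - a) * (c - b) * gaussCoeff (c + 1 - a) (c + 1 - b) (c + 1 - a - b + 1) m := by
        have hm : (m : ℂ) + 1 ≠ 0 := Nat.cast_add_one_ne_zero m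
        have hf : (m.factorial : ℂ) ≠ 0 := Nat.cast_ne_zero.2 m.factorial_ne_zero
        have ha (x : ℂ) : (ascPochhammer ℂ (m + 1)).eval x = x * (ascPochhammer ℂ m).eval (x + 1) := by
          rw [ascPochhammer_succ_left]
          simp
        simp only [gaussCoeff, ha, Nat.factorial_succ, Nat.cast_mul, Nat.cast_add, Nat.cast_one,
          sub_add_eq_add_sub]
        rw [show c + 1 + ((m : ℂ) + 1) - a - b = c + 1 + 1 + m - a - b by ring]
        field_simp
      have hm : (m : ℂ) + 1 ≠ 0 := Nat.cast_add_one_ne_zero m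
      -- The recurrences `e1` and `e2` both carry the factor m + 1.
      rw [← mul_right_inj' hm]
      cases m with
      | zero =>
        simp only [shift]
        push_cast at *
        linear_combination -e1 + e2
      | succ m =>
        simp only [shift]
        push_cast at *
        linear_combination -e1 + e2

/-! ### Behaviour for large c. -/

theorem HasUnitSeries.norm_sub_le {u : ℕ → ℂ} {f : ℂ → ℂ} (hf : HasUnitSeries u f) {B : ℝ}
    (hB : ∀ M, ∑ m ∈ Finset.range M, ‖u (m + 1)‖ ≤ B) {z : ℂ} (hz : ‖z‖ < 1) :
    ‖f z - u 0‖ ≤ B := by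
  have h := ((hasSum_nat_add_iff' 1).2 (hf z hz)).tendsto_sum_nat
  simp only [Finset.range_one, Finset.sum_singleton, pow_zero, mul_one] at h
  refine le_of_tendsto h.norm (Eventually.of_forall fun M => ?_)
  refine (norm_sum_le _ _).trans (le_trans (Finset.sum_le_sum fun m _ => ?_) (hB M))
  rw [norm_mul, norm_pow]
  exact mul_le_of_le_one_right (norm_nonneg _) (pow_le_one₀ (norm_nonneg _) hz.le)

/-- The recurrence bounds (m + 1)(Re c + m)|u (m + 1)| by (p + m)²|u m|. Summing over m, each |u m|
with m ≥ 1 keeps the weight m(Re c - 1 - 2p) - p², which is at least Re c - 1 - 2p - p². The last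
term is kept so that the induction closes. -/
theorem sum_norm_gaussCoeff_le {a b c : ℂ} {p : ℝ} (ha : ‖a‖ ≤ p) (hb : ‖b‖ ≤ p)
    (hc : p ^ 2 + 2 * p + 1 < c.re) (M : ℕ) :
    (c.re - 1 - 2 * p - p ^ 2) * ∑ m ∈ Finset.range M, ‖gaussCoeff a b c (m + 1)‖
      + (M + 1) * (c.re + M) * ‖gaussCoeff a b c (M + 1)‖ ≤ p ^ 2 * ‖gaussCoeff a b c 0‖ := by
  have hp : 0 ≤ p := (norm_nonneg a).trans ha
  have hstep : ∀ m : ℕ, (m + 1) * (c.re + m) * ‖gaussCoeff a b c (m + 1)‖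
      ≤ (p + m) ^ 2 * ‖gaussCoeff a b c m‖ := by
    intro m
    have h := congrArg norm (gaussCoeff_succ a b c m)
    simp only [norm_mul] at h
    have h1 : ‖(m : ℂ) + 1‖ = m + 1 := by
      exact_mod_cast Complex.norm_natCast (m + 1)
    have h2 : c.re + m ≤ ‖c + m‖ := by
      simpa using re_le_norm (c + m)
    have h3 : ‖a + m‖ ≤ p + m := (norm_add_le _ _).trans (by simpa using ha)
    have h4 : ‖b + m‖ ≤ p + m := (norm_add_le _ _).trans (by simpa using hb)
    rw [h1] at h
    calc (m + 1) * (c.re + m) * ‖gaussCoeff a b c (m + 1)‖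
        ≤ (m + 1) * ‖c + m‖ * ‖gaussCoeff a b c (m + 1)‖ := by gcongr
      _ = ‖a + m‖ * ‖b + m‖ * ‖gaussCoeff a b c m‖ := h
      _ ≤ (p + m) * (p + m) * ‖gaussCoeff a b c m‖ := by gcongr
      _ = (p + m) ^ 2 * ‖gaussCoeff a b c m‖ := by ring
  induction M with
  | zero => simpa using hstep 0
  | succ M ih =>
    rw [Finset.sum_range_succ]
    have h := hstep (M + 1)
    have h0 : 0 ≤ (M : ℝ) * (c.re - 1 - 2 * p) * ‖gaussCoeff a b c (M + 1)‖ := by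
      have : 0 ≤ c.re - 1 - 2 * p := by nlinarith
      positivity
    push_cast at h ⊢
    nlinarith

/-- The relative error against 1/Γ(c) is O(1/Re c) uniformly on the disc, so the bound survives the
limit z → 1. -/
theorem norm_regularizedGaussHGFun_sub_le {a b c : ℂ} {p : ℝ} (ha : ‖a‖ ≤ p) (hb : ‖b‖ ≤ p)
    (hc : p ^ 2 + 2 * p + 1 < c.re) {z : ℂ} (hz : ‖z‖ < 1) :
    ‖regularizedGaussHGFun a b c z - (Gamma c)⁻¹‖
      ≤ p ^ 2 / (c.re - 1 - 2 * p - p ^ 2) * ‖(Gamma c)⁻¹‖ := by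
  rw [← gaussCoeff_zero a b c]
  refine (hasUnitSeries_regularizedGaussHGFun a b c).norm_sub_le (fun M => ?_) hz
  have hp : 0 ≤ p := (norm_nonneg a).trans ha
  have hk : 0 < c.re - 1 - 2 * p - p ^ 2 := by linarith
  have hcp : 0 < c.re := by nlinarith
  have h := sum_norm_gaussCoeff_le ha hb hc M
  rw [div_mul_eq_mul_div, le_div_iff₀ hk, mul_comm]
  refine le_trans (le_add_of_nonneg_right ?_) h
  positivity

/-- Euler's limit for Γ, divided by Γ(x). -/
theorem tendsto_natCast_cpow_mul_factorial_div_Gamma {x : ℂ} (hx : 0 < x.re) :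
    Tendsto (fun N : ℕ => (N : ℂ) ^ x * (N.factorial : ℂ) * (Gamma (x + (N + 1 : ℕ)))⁻¹)
      atTop (𝓝 1) := by
  have hx' : ∀ k : ℕ, x ≠ -k := by
    rintro k rfl
    simp at hx
    linarith [k.cast_nonneg (α := ℝ)]
  have hg := Gamma_ne_zero hx'
  have h := (GammaSeq_tendsto_Gamma x).mul_const (Gamma x)⁻¹
  rw [mul_inv_cancel₀ hg] at h
  refine h.congr fun N => ?_
  have e := Gamma_add_nat_div_Gamma_eq (n := N + 1) x hx'
  have e2 : (ascPochhammer ℂ (N + 1)).eval x = ∏ j ∈ Finset.range (N + 1), (x + j) := by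
    generalize N + 1 = k
    induction k with
    | zero => simp
    | succ k ih => rw [ascPochhammer_succ_eval, ih, Finset.prod_range_succ]
  rw [GammaSeq, ← e2, ← e]
  field_simp

theorem tendsto_Gamma_ratio {x y w v : ℂ} (hx : 0 < x.re) (hy : 0 < y.re) (hw : 0 < w.re)
    (hv : 0 < v.re) (h : x + y = w + v) :
    Tendsto (fun N : ℕ => Gamma (x + (N + 1 : ℕ)) * Gamma (y + (N + 1 : ℕ))
      / (Gamma (w + (N + 1 : ℕ)) * Gamma (v + (N + 1 : ℕ)))) atTop (𝓝 1) := by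
  have h1 := ((tendsto_natCast_cpow_mul_factorial_div_Gamma hw).mul
    (tendsto_natCast_cpow_mul_factorial_div_Gamma hv)).div
    ((tendsto_natCast_cpow_mul_factorial_div_Gamma hx).mul
    (tendsto_natCast_cpow_mul_factorial_div_Gamma hy)) (by simp)
  rw [one_mul, div_one] at h1
  refine h1.congr' ?_
  filter_upwards [eventually_ge_atTop 1] with N hN
  have hN0 : (N : ℂ) ≠ 0 := by exact_mod_cast (Nat.one_le_iff_ne_zero.1 hN)
  have hf : (N.factorial : ℂ) ≠ 0 := Nat.cast_ne_zero.2 N.factorial_ne_zero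
  have hp : (N : ℂ) ^ x * (N : ℂ) ^ y = (N : ℂ) ^ w * (N : ℂ) ^ v := by
    rw [← cpow_add _ _ hN0, ← cpow_add _ _ hN0, h]
  have hG : ∀ t : ℂ, 0 < t.re → Gamma (t + (N + 1 : ℕ)) ≠ 0 := fun t ht =>
    Gamma_ne_zero_of_re_pos (by simp; positivity)
  have g1 := hG x hx
  have g2 := hG y hy
  have g3 := hG w hw
  have g4 := hG v hv
  have p1 : (N : ℂ) ^ x ≠ 0 := by simp [cpow_eq_zero_iff, hN0]
  have p2 : (N : ℂ) ^ y ≠ 0 := by simp [cpow_eq_zero_iff, hN0]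
  simp only [Pi.div_apply]
  field_simp
  linear_combination -hp

/-! ### Lowering c in a connection formula, and Gauss's summation theorem. -/

theorem lower_eq {a b c A B : ℂ}
    (h : ∀ z ∈ lens, regularizedGaussHGFun a b (c + 1) z
      = A * regularAtOne a b (c + 1) z + B * singularAtOne a b (c + 1) z) :
    ∀ z ∈ lens, regularizedGaussHGFun a b c z
      = -(A * ((c - a) * (c - b))) * regularAtOne a b c z + -B * singularAtOne a b c z := by
  intro z hz
  obtain ⟨_, h1⟩ := isGaussSol_regularAtOne a b (c + 1)
  obtain ⟨_, h2⟩ := isGaussSol_singularAtOne a b (c + 1)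
  have hd : deriv (regularizedGaussHGFun a b (c + 1)) z
      = A * regularAtOneDeriv a b (c + 1) z + B * singularAtOneDeriv a b (c + 1) z := by
    have e : regularizedGaussHGFun a b (c + 1) =ᶠ[𝓝 z]
        fun z => A * regularAtOne a b (c + 1) z + B * singularAtOne a b (c + 1) z := by
      filter_upwards [isOpen_lens.mem_nhds hz] with w hw using h w hw
    rw [e.deriv_eq]
    exact (((h1 z hz).1.const_mul A).add ((h2 z hz).1.const_mul B)).deriv
  rw [← regularizedGaussHGFun_lower a b c (mem_lens.1 hz).1, hd, h z hz]
  linear_combination A * regularAtOne_lower a b c hz + B * singularAtOne_lower a b c hz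

/-- Gauss's summation theorem, as a limit at the boundary point `1`. -/
theorem tendsto_regularizedGaussHGFun_one {a b c : ℂ} (hs : ∀ m : ℤ, c - a - b ≠ m)
    (hre : 0 < (c - a - b).re) :
    Tendsto (regularizedGaussHGFun a b c) (𝓝[lens] 1)
      (𝓝 ((Gamma (c - a))⁻¹ * (Gamma (c - b))⁻¹ * Gamma (c - a - b))) := by
  have hsN : ∀ (N : ℕ) (m : ℤ), c + N - a - b ≠ m := fun N m hm =>
    hs (m - N) (by push_cast; linear_combination hm)
  have hreN : ∀ N : ℕ, 0 < (c + N - a - b).re := fun N => by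
    simp at hre ⊢
    linarith [N.cast_nonneg (α := ℝ)]
  -- The expansion at 1 shows that the limit `l N` exists for c + N; lowering c gives its
  -- recurrence, which the Gamma quotient `t N` satisfies too.
  choose A B hAB using fun N : ℕ =>
    exists_eq_add (hsN N) (isGaussSol_regularizedGaussHGFun a b (c + N))
  set l : ℕ → ℂ := fun N => A N * (Gamma (a + b + 1 - (c + N)))⁻¹ with hl
  have hlN : ∀ N : ℕ, Tendsto (regularizedGaussHGFun a b (c + N)) (𝓝[lens] 1) (𝓝 (l N)) :=
    fun N => tendsto_of_eq_add (hreN N) (hAB N)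
  have hrec : ∀ N : ℕ, (c + N - a - b) * l N = (c + N - a) * (c + N - b) * l (N + 1) := by
    intro N
    have h1 := hAB (N + 1)
    push_cast at h1
    rw [← add_assoc] at h1
    have h2 := tendsto_nhds_unique (hlN N) (tendsto_of_eq_add (hreN N) (lower_eq h1))
    have h3 := one_div_Gamma_eq_self_mul_one_div_Gamma_add_one (a + b + 1 - (c + (N + 1 : ℕ)))
    rw [show a + b + 1 - (c + (N + 1 : ℕ)) + 1 = a + b + 1 - (c + N) by push_cast; ring] at h3
    rw [h2]
    simp only [hl]
    rw [h3]
    push_cast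
    ring
  have hGrec (N : ℕ) (x : ℂ) : (Gamma (x + N))⁻¹ = (x + N) * (Gamma (x + (N + 1 : ℕ)))⁻¹ := by
    have := one_div_Gamma_eq_self_mul_one_div_Gamma_add_one (x + N)
    push_cast
    rwa [← add_assoc]
  have hGne (N : ℕ) (x : ℂ) (hx : 0 < (x + N).re) : Gamma (x + N) ≠ 0 :=
    Gamma_ne_zero_of_re_pos hx
  let t : ℕ → ℂ := fun N =>
    (Gamma (c - a + N))⁻¹ * (Gamma (c - b + N))⁻¹ * Gamma (c - a - b + N)
  have htrec : ∀ N : ℕ, (c + N - a - b) * t N = (c + N - a) * (c + N - b) * t (N + 1) := by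
    intro N
    have hne : c - a - b + N ≠ 0 := by
      have := hsN N 0
      intro h
      exact this (by push_cast; linear_combination h)
    have := Gamma_add_one _ hne
    simp only [t]
    rw [hGrec N (c - a), hGrec N (c - b)]
    rw [add_assoc (c - a - b)] at this
    push_cast
    rw [this]
    ring
  -- Going down only divides by c + N - a - b, which never vanishes; going up would divide by c + N
  -- - a and c + N - b, which may.
  have hdown : ∀ N : ℕ, l N = t N → l 0 = t 0 := by
    intro N
    induction N with
    | zero => exact id
    | succ N ih =>
      intro h
      refine ih (mul_left_cancel₀ (a := c + N - a - b) (by simpa using hsN N 0) ?_)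
      rw [hrec, htrec, h]
  obtain ⟨p, hap, hbp⟩ : ∃ p : ℝ, ‖a‖ ≤ p ∧ ‖b‖ ≤ p := ⟨max ‖a‖ ‖b‖, le_max_left _ _, le_max_right _ _⟩
  -- Beyond N₀ all Gamma arguments have positive real part and the large-c estimate applies, so l/t
  -- is constant from there on.
  obtain ⟨N₀, hN₀⟩ : ∃ N₀ : ℕ, |(c - a).re| + |(c - b).re| + |c.re| + (p ^ 2 + 2 * p + 1) < N₀ :=
    exists_nat_gt _
  have hp : 0 ≤ p := (norm_nonneg a).trans hap
  have hpos : ∀ x : ℂ, |x.re| < N₀ → 0 < (x + N₀).re := fun x hx => by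
    rw [add_re, natCast_re]
    linarith [(abs_lt.1 hx).1]
  have h1 : 0 < (c - a + N₀).re := hpos _ (by
    linarith [abs_nonneg (c - a).re, abs_nonneg (c - b).re, abs_nonneg c.re, sq_nonneg p])
  have h2 : 0 < (c - b + N₀).re := hpos _ (by
    linarith [abs_nonneg (c - a).re, abs_nonneg (c - b).re, abs_nonneg c.re, sq_nonneg p])
  have h3 : 0 < (c + N₀).re := hpos _ (by
    linarith [abs_nonneg (c - a).re, abs_nonneg (c - b).re, abs_nonneg c.re, sq_nonneg p])
  have h4 : 0 < (c - a - b + N₀).re := by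
    have := hreN N₀
    rwa [show c + N₀ - a - b = c - a - b + N₀ by ring] at this
  have h5 : p ^ 2 + 2 * p + 1 < (c + N₀).re := by
    rw [add_re, natCast_re]
    linarith [neg_abs_le c.re, abs_nonneg (c - a).re, abs_nonneg (c - b).re]
  have hcast (x : ℂ) (M : ℕ) : x + (N₀ + M : ℕ) = x + N₀ + M := by push_cast; ring
  have hposM (x : ℂ) (hx : 0 < (x + N₀).re) (M : ℕ) : 0 < (x + (N₀ + M : ℕ)).re := by
    rw [hcast, add_re _ (M : ℂ), natCast_re]
    positivity
  have htne : ∀ M : ℕ, t (N₀ + M) ≠ 0 := fun M =>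
    mul_ne_zero (mul_ne_zero (inv_ne_zero (hGne _ _ (hposM _ h1 M)))
      (inv_ne_zero (hGne _ _ (hposM _ h2 M)))) (hGne _ _ (hposM _ h4 M))
  have hconst : ∀ M : ℕ, l (N₀ + M) / t (N₀ + M) = l N₀ / t N₀ := by
    intro M
    induction M with
    | zero => rfl
    | succ M ih =>
      rw [← ih, div_eq_div_iff (htne (M + 1)) (htne M)]
      have k1 : c + (N₀ + M : ℕ) - a ≠ 0 := by
        have := hposM _ h1 M
        rw [show c - a + (N₀ + M : ℕ) = c + (N₀ + M : ℕ) - a by ring] at this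
        intro h
        rw [h, zero_re] at this
        exact lt_irrefl _ this
      have k2 : c + (N₀ + M : ℕ) - b ≠ 0 := by
        have := hposM _ h2 M
        rw [show c - b + (N₀ + M : ℕ) = c + (N₀ + M : ℕ) - b by ring] at this
        intro h
        rw [h, zero_re] at this
        exact lt_irrefl _ this
      refine mul_left_cancel₀ (mul_ne_zero k1 k2) ?_
      have e1 := hrec (N₀ + M)
      have e2 := htrec (N₀ + M)
      rw [← add_assoc]
      linear_combination l (N₀ + M) * e2 - t (N₀ + M) * e1
  -- Both l Γ(c + N) and 1/(t Γ(c + N)) tend to 1, hence the constant ratio l/t is 1.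
  have hgam := tendsto_Gamma_ratio h1 h2 h3 h4 (by ring)
  have hl1 : Tendsto (fun M : ℕ => l (N₀ + (M + 1)) * Gamma (c + N₀ + (M + 1 : ℕ))) atTop (𝓝 1) := by
    rw [tendsto_iff_norm_sub_tendsto_zero]
    have hbd : ∀ M : ℕ, ‖l (N₀ + (M + 1)) * Gamma (c + N₀ + (M + 1 : ℕ)) - 1‖
        ≤ p ^ 2 / ((c + N₀).re - 1 - 2 * p - p ^ 2 + M) := by
      intro M
      have hre' : (c + (N₀ + (M + 1) : ℕ)).re = (c + N₀).re + (M + 1) := by simp [add_assoc]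
      have hGam : Gamma (c + (N₀ + (M + 1) : ℕ)) ≠ 0 := hGne _ _ (hposM _ h3 _)
      have hb : ‖l (N₀ + (M + 1)) - (Gamma (c + (N₀ + (M + 1) : ℕ)))⁻¹‖ ≤
          p ^ 2 / ((c + (N₀ + (M + 1) : ℕ)).re - 1 - 2 * p - p ^ 2)
            * ‖(Gamma (c + (N₀ + (M + 1) : ℕ)))⁻¹‖ := by
        refine le_of_tendsto ((hlN (N₀ + (M + 1))).sub_const _).norm ?_
        filter_upwards [self_mem_nhdsWithin] with z hz
        refine norm_regularizedGaussHGFun_sub_le hap hbp ?_ (mem_lens.1 hz).1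
        rw [hre']
        linarith [M.cast_nonneg (α := ℝ)]
      rw [← hcast]
      have e : l (N₀ + (M + 1)) * Gamma (c + (N₀ + (M + 1) : ℕ)) - 1
          = (l (N₀ + (M + 1)) - (Gamma (c + (N₀ + (M + 1) : ℕ)))⁻¹)
            * Gamma (c + (N₀ + (M + 1) : ℕ)) := by
        field_simp
      rw [e, norm_mul]
      refine (mul_le_mul_of_nonneg_right hb (norm_nonneg _)).trans ?_
      rw [mul_assoc, ← norm_mul, inv_mul_cancel₀ hGam, norm_one, mul_one, hre']
      refine div_le_div_of_nonneg_left (sq_nonneg p) ?_ ?_ <;>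
        linarith [M.cast_nonneg (α := ℝ)]
    refine squeeze_zero (fun _ => norm_nonneg _) hbd ?_
    exact tendsto_const_nhds.div_atTop
      (tendsto_atTop_add_const_left _ _ tendsto_natCast_atTop_atTop)
  have hone : l N₀ / t N₀ = 1 := by
    refine tendsto_nhds_unique (l := atTop) (f := fun _ : ℕ => l N₀ / t N₀) tendsto_const_nhds ?_
    have := hl1.mul hgam
    rw [one_mul] at this
    refine this.congr fun M => ?_
    rw [← hconst (M + 1)]
    simp only [t, hcast]
    have g3 := hGne _ _ (hposM _ h3 (M + 1))
    have g4 := hGne _ _ (hposM _ h4 (M + 1))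
    rw [hcast] at g3 g4
    have g1 := hGne _ _ (hposM _ h1 (M + 1))
    have g2 := hGne _ _ (hposM _ h2 (M + 1))
    rw [hcast] at g1 g2
    field_simp
  have hfin := hdown N₀ ((div_eq_one_iff_eq (htne 0)).1 hone)
  have := hlN 0
  rw [hfin] at this
  simpa [t] using this

/-! ### The connection formula between 0 and 1. -/

/-- The coefficient of the solution regular at `1` in the connection formula. -/
noncomputable def regularCoeff (a b c : ℂ) : ℂ :=
  (Real.pi : ℂ) / sin (Real.pi * (c - a - b)) * (Gamma (c - a))⁻¹ * (Gamma (c - b))⁻¹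

/-- The coefficient of the singular solution in the connection formula. -/
noncomputable def singularCoeff (a b c : ℂ) : ℂ :=
  -((Real.pi : ℂ) / sin (Real.pi * (c - a - b))) * (Gamma a)⁻¹ * (Gamma b)⁻¹

theorem sin_pi_mul_add_one (s : ℂ) : sin (Real.pi * (s + 1)) = -sin (Real.pi * s) := by
  rw [mul_add, mul_one, sin_add_pi]

theorem regularCoeff_lower (a b c : ℂ) :
    -(regularCoeff a b (c + 1) * ((c - a) * (c - b))) = regularCoeff a b c := by
  have h1 := one_div_Gamma_eq_self_mul_one_div_Gamma_add_one (c - a)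
  have h2 := one_div_Gamma_eq_self_mul_one_div_Gamma_add_one (c - b)
  simp only [regularCoeff]
  rw [h1, h2, show c + 1 - a - b = c - a - b + 1 by ring, sin_pi_mul_add_one, div_neg,
    show c - a + 1 = c + 1 - a by ring, show c - b + 1 = c + 1 - b by ring]
  ring

theorem singularCoeff_lower (a b c : ℂ) : -singularCoeff a b (c + 1) = singularCoeff a b c := by
  simp only [singularCoeff]
  rw [show c + 1 - a - b = c - a - b + 1 by ring, sin_pi_mul_add_one, div_neg]
  ring

theorem Gamma_one_sub_ne_zero {a b c : ℂ} (hs : ∀ m : ℤ, c - a - b ≠ m) :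
    Gamma (a + b + 1 - c) ≠ 0 :=
  Gamma_ne_zero fun m hm => hs (m + 1) (by push_cast; linear_combination -hm)

/-- If Re(c - a - b) > 0, the singular solution vanishes at 1 and Gauss's theorem gives the
coefficient, rewritten by the reflection formula. Otherwise c is lowered from c + N. -/
theorem exists_eq_regularCoeff_add (N : ℕ) {a b c : ℂ} (hs : ∀ m : ℤ, c - a - b ≠ m)
    (hre : 0 < (c - a - b).re + N) :
    ∃ B : ℂ, ∀ z ∈ lens, regularizedGaussHGFun a b c z
      = regularCoeff a b c * regularAtOne a b c z + B * singularAtOne a b c z := by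
  induction N generalizing c with
  | zero =>
    rw [Nat.cast_zero, add_zero] at hre
    obtain ⟨A, B, h⟩ := exists_eq_add hs (isGaussSol_regularizedGaussHGFun a b c)
    have e := tendsto_nhds_unique (tendsto_of_eq_add hre h)
      (tendsto_regularizedGaussHGFun_one hs hre)
    have hG := Gamma_one_sub_ne_zero hs
    have hr := Gamma_mul_Gamma_one_sub (c - a - b)
    rw [show 1 - (c - a - b) = a + b + 1 - c by ring] at hr
    have hA : A = regularCoeff a b c := by
      rw [regularCoeff, ← hr]
      field_simp at e
      rw [e]
      field_simp
    exact ⟨B, hA ▸ h⟩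
  | succ N ih =>
    have h1 : ∀ m : ℤ, c + 1 - a - b ≠ m := fun m hm =>
      hs (m - 1) (by push_cast; linear_combination hm)
    obtain ⟨B, hB⟩ := ih h1 (by
      push_cast at hre
      rw [show c + 1 - a - b = c - a - b + 1 by ring, add_re, one_re]
      linarith)
    refine ⟨-B, ?_⟩
    have := lower_eq hB
    rwa [regularCoeff_lower] at this

theorem HasUnitSeries.tendsto_lens_zero {u : ℕ → ℂ} {f : ℂ → ℂ} (hf : HasUnitSeries u f) :
    Tendsto f (𝓝[lens] 0) (𝓝 (u 0)) := by
  have h := hf.continuousAt_zero.tendsto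
  rw [hf.apply_zero] at h
  exact h.mono_left nhdsWithin_le_nhds

theorem tendsto_one_sub_cpow_lens_zero (s : ℂ) :
    Tendsto (fun z : ℂ => (1 - z) ^ s) (𝓝[lens] 0) (𝓝 1) := by
  have h := (hasDerivAt_one_sub_cpow s (z := 0) (by simp)).continuousAt.tendsto
  simp only [sub_zero, one_cpow] at h
  exact h.mono_left nhdsWithin_le_nhds

/-- Euler's transformation. -/
theorem regularizedGaussHGFun_euler {a b c : ℂ} (hs : ∀ m : ℤ, c - a - b ≠ m) (hc : 0 < c.re) :
    ∀ z ∈ lens, regularizedGaussHGFun a b c z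
      = (1 - z) ^ (c - a - b) * regularizedGaussHGFun (c - a) (c - b) c z := by
  have hu := isGaussSol_regularizedGaussHGFun a b c
  have hv := (isGaussSol_regularizedGaussHGFun (c - a) (c - b) c).euler
  have s1 := hasUnitSeries_regularizedGaussHGFun a b c
  have s2 := hasUnitSeries_regularizedGaussHGFun (c - a) (c - b) c
  have lu := s1.tendsto_lens_zero
  have lu' := s1.derivative.tendsto_lens_zero
  have l2 := s2.tendsto_lens_zero
  have l2' := s2.derivative.tendsto_lens_zero
  have lp := tendsto_one_sub_cpow_lens_zero (c - a - b)
  have lq : Tendsto (fun z : ℂ => 1 - z) (𝓝[lens] 0) (𝓝 1) := by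
    simpa using tendsto_one_sub_cpow_lens_zero 1
  have lv := lp.mul l2
  have lv' := lp.mul (l2'.sub ((l2.const_mul (c - a - b)).div lq one_ne_zero))
  rw [gaussCoeff_zero] at lu lv
  rw [one_mul] at lv
  set u := regularizedGaussHGFun a b c
  set u' := deriv u
  set v : ℂ → ℂ := fun z => (1 - z) ^ (c - a - b) * regularizedGaussHGFun (c - a) (c - b) c z
  set v' : ℂ → ℂ := fun z => (1 - z) ^ (c - a - b)
    * (deriv (regularizedGaussHGFun (c - a) (c - b) c) z
      - (c - a - b) * regularizedGaussHGFun (c - a) (c - b) c z / (1 - z))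
  -- The weight contains z^c, which tends to 0 at 0 because Re c > 0, while both solutions and their
  -- derivatives stay bounded.
  have hvu : ∀ z ∈ lens, gaussWronskian a b c v v' u u' z = 0 := by
    obtain ⟨k, hk⟩ := hv.exists_gaussWronskian_eq hu
    have := ((tendsto_cpow_lens_zero hc).mul (tendsto_one_sub_cpow_lens_zero (a + b + 1 - c))).mul
      ((lv.mul lu').sub (lv'.mul lu))
    rw [zero_mul, zero_mul] at this
    have hk0 : k = 0 := by
      refine tendsto_nhds_unique (l := 𝓝[lens] (0 : ℂ)) (f := fun _ => k) tendsto_const_nhds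
        (this.congr' ?_)
      filter_upwards [self_mem_nhdsWithin] with z hz using hk z hz
    intro z hz
    rw [hk z hz, hk0]
  have hG : (Gamma c)⁻¹ ≠ 0 := inv_ne_zero (Gamma_ne_zero_of_re_pos hc)
  -- Since W(v, u) = 0, the three-term identity gives W(v, w) u = W(u, w) v, and the common nonzero
  -- value at 0 makes the two constants equal. So u = v unless W(u, w) = 0; if that held for both
  -- local solutions at 1, u would vanish.
  have hmain : ∀ w w' : ℂ → ℂ, IsGaussSol a b c w w' →
      (∀ z ∈ lens, u z = v z) ∨ ∀ z ∈ lens, gaussWronskian a b c u u' w w' z = 0 := by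
    intro w w' hw
    obtain ⟨k, hk⟩ := hv.exists_gaussWronskian_eq hw
    obtain ⟨l, hl⟩ := hu.exists_gaussWronskian_eq hw
    have hkl : ∀ z ∈ lens, k * u z = l * v z := by
      intro z hz
      have := gaussWronskian_cycle a b c u u' v v' w w' z
      rwa [hk z hz, hl z hz, hvu z hz, zero_mul, add_zero] at this
    have e : k = l := by
      refine mul_right_cancel₀ hG (tendsto_nhds_unique (lu.const_mul k)
        ((lv.const_mul l).congr' ?_))
      filter_upwards [self_mem_nhdsWithin] with z hz using (hkl z hz).symm
    by_cases hl0 : l = 0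
    · exact Or.inr fun z hz => by rw [hl z hz, hl0]
    · refine Or.inl fun z hz => mul_left_cancel₀ hl0 ?_
      rw [← hkl z hz, e]
  rcases hmain _ _ (isGaussSol_regularAtOne a b c) with h | h1
  · exact h
  rcases hmain _ _ (isGaussSol_singularAtOne a b c) with h | h2
  · exact h
  refine absurd (tendsto_nhds_unique lu (tendsto_const_nhds.congr' ?_)) hG
  filter_upwards [self_mem_nhdsWithin] with z hz
  have := gaussWronskian_cycle a b c u u' (regularAtOne a b c) (regularAtOneDeriv a b c)
    (singularAtOne a b c) (singularAtOneDeriv a b c) z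
  have h3 : gaussWronskian a b c (regularAtOne a b c) (regularAtOneDeriv a b c) u u' z = 0 := by
    have := h1 z hz
    simp only [gaussWronskian] at this ⊢
    linear_combination -this
  rw [h2 z hz, h3, zero_mul, zero_mul, add_zero,
    gaussWronskian_regularAtOne_singularAtOne a b c hz] at this
  have h0 := inv_Gamma_mul_ne_zero hs
  rw [show 1 - (c - a - b) = a + b + 1 - c by ring] at h0
  exact ((mul_eq_zero.1 this).resolve_left h0).symm

/-- The connection formula between `0` and `1` for the regularized Gauss function. -/
theorem regularizedGaussHGFun_connection {a b c : ℂ} (hs : ∀ m : ℤ, c - a - b ≠ m) :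
    ∀ z ∈ lens, regularizedGaussHGFun a b c z
      = regularCoeff a b c * regularAtOne a b c z
        + singularCoeff a b c * singularAtOne a b c z := by
  suffices H : ∀ (N : ℕ) (c : ℂ), (∀ m : ℤ, c - a - b ≠ m) → 0 < (c - a - b).re + N →
      0 < c.re + N → ∀ z ∈ lens, regularizedGaussHGFun a b c z
        = regularCoeff a b c * regularAtOne a b c z
          + singularCoeff a b c * singularAtOne a b c z by
    obtain ⟨N, hN⟩ := exists_nat_gt (|(c - a - b).re| + |c.re|)
    refine H N c hs ?_ ?_
    · linarith [neg_abs_le (c - a - b).re, abs_nonneg c.re]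
    · linarith [neg_abs_le c.re, abs_nonneg (c - a - b).re]
  intro N
  induction N with
  | zero =>
    intro c hs hre hc
    rw [Nat.cast_zero, add_zero] at hre hc
    obtain ⟨N, hN⟩ := exists_nat_gt (|(c - (c - a) - (c - b)).re|)
    have hs' : ∀ m : ℤ, c - (c - a) - (c - b) ≠ m := fun m hm =>
      hs (-m) (by push_cast; linear_combination -hm)
    obtain ⟨B, hB⟩ := exists_eq_regularCoeff_add N hs'
      (by linarith [neg_abs_le (c - (c - a) - (c - b)).re])
    -- Multiplication by (1 - z)^(c-a-b) exchanges the two local solutions, so the regular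
    -- coefficient for (c - a, c - b, c) becomes the singular one for (a, b, c).
    have hf : ∀ z ∈ lens, regularizedGaussHGFun a b c z
        = B * regularAtOne a b c z + singularCoeff a b c * singularAtOne a b c z := by
      intro z hz
      have hne : (1 - z) ≠ 0 := slitPlane_ne_zero (mem_slitPlane_of_mem_lens (one_sub_mem_lens hz))
      rw [regularizedGaussHGFun_euler hs hc z hz, hB z hz]
      have e1 : c - (c - a) - (c - b) = -(c - a - b) := by ring
      have e2 : regularCoeff (c - a) (c - b) c = singularCoeff a b c := by
        rw [regularCoeff, singularCoeff, e1, mul_neg, sin_neg, div_neg, sub_sub_cancel,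
          sub_sub_cancel]
      have e3 : (1 - z) ^ (c - a - b) * regularAtOne (c - a) (c - b) c z
          = singularAtOne a b c z := by
        rw [regularAtOne, singularAtOne, show c - a + (c - b) + 1 - c = c - a - b + 1 by ring]
      have e4 : (1 - z) ^ (c - a - b) * singularAtOne (c - a) (c - b) c z
          = regularAtOne a b c z := by
        rw [regularAtOne, singularAtOne, e1, sub_sub_cancel, sub_sub_cancel, ← mul_assoc,
          ← cpow_add _ _ hne, add_neg_cancel, cpow_zero, one_mul,
          show -(c - a - b) + 1 = a + b + 1 - c by ring]
      rw [e2]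
      linear_combination singularCoeff a b c * e3 + B * e4
    obtain ⟨B', hB'⟩ := exists_eq_regularCoeff_add 0 hs (by simpa using hre)
    -- Both expansions have the same limit at 1, which identifies B.
    have e := mul_right_cancel₀ (inv_ne_zero (Gamma_one_sub_ne_zero hs))
      (tendsto_nhds_unique (tendsto_of_eq_add hre hf) (tendsto_of_eq_add hre hB'))
    rwa [e] at hf
  | succ N ih =>
    intro c hs hre hc
    push_cast at hre hc
    have := lower_eq (ih (c + 1) (fun m hm => hs (m - 1) (by push_cast; linear_combination hm)) (by
      rw [show c + 1 - a - b = c - a - b + 1 by ring, add_re, one_re]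
      linarith) (by
      rw [add_re, one_re]
      linarith))
    rwa [regularCoeff_lower, singularCoeff_lower] at this

/-! ### The cut disc and analytic continuation. -/

/-- The unit disc around `1`, cut along `[1, 2)`. -/
def cutDisc : Set ℂ := {z | ‖1 - z‖ < 1 ∧ 1 - z ∈ slitPlane}

theorem isOpen_cutDisc : IsOpen cutDisc :=
  (isOpen_lt (f := fun z : ℂ => ‖1 - z‖) (g := fun _ => 1) (by fun_prop) continuous_const).inter
    (isOpen_slitPlane.preimage (f := fun z : ℂ => 1 - z) (by fun_prop))

theorem lens_subset_cutDisc : lens ⊆ cutDisc := fun _ hz =>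
  ⟨(mem_lens.1 hz).2, mem_slitPlane_of_mem_lens (one_sub_mem_lens hz)⟩

theorem ne_zero_of_mem_cutDisc {z : ℂ} (hz : z ∈ cutDisc) : z ≠ 0 := by
  rintro rfl
  simpa using hz.1

theorem half_mem_lens : ((1 / 2 : ℝ) : ℂ) ∈ lens := ofReal_mem_lens (by norm_num) (by norm_num)

theorem isPreconnected_cutDisc : IsPreconnected cutDisc := by
  have h : StarConvex ℝ (((1 / 2 : ℝ) : ℂ)) cutDisc := by
    intro y hy s t hs ht hst
    have e : 1 - (s • (((1 / 2 : ℝ) : ℂ)) + t • y) = s • (((1 / 2 : ℝ) : ℂ)) + t • (1 - y) := by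
      have : (s : ℂ) + t = 1 := by exact_mod_cast hst
      simp only [real_smul]
      push_cast
      linear_combination -this
    refine ⟨?_, ?_⟩
    · have := convex_ball (0 : ℂ) 1 (mem_ball_zero_iff.2 (mem_lens.1 half_mem_lens).1)
        (mem_ball_zero_iff.2 hy.1) hs ht hst
      rw [e]
      exact mem_ball_zero_iff.1 this
    · rw [e]
      exact starConvex_ofReal_slitPlane (by norm_num) hy.2 hs ht hst
  exact (h.isPathConnected (lens_subset_cutDisc half_mem_lens)).isConnected.isPreconnected

theorem starConvex_ball_union_cutDisc : StarConvex ℝ 0 (Metric.ball (0 : ℂ) 1 ∪ cutDisc) := by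
  refine starConvex_zero_iff.2 fun y hy t ht0 ht1 => ?_
  rcases hy with hy | hy
  · exact Or.inl ((convex_ball (0 : ℂ) 1).starConvex (by simp) |>.smul_mem hy ht0 ht1)
  · rcases ht0.eq_or_lt with rfl | ht0
    · simp
    have e : 1 - t • y = (1 - t) • (1 : ℂ) + t • (1 - y) := by
      simp only [real_smul]
      push_cast
      ring
    refine Or.inr ⟨?_, ?_⟩
    · rw [e]
      refine (norm_add_le _ _).trans_lt ?_
      rw [norm_smul, norm_smul, norm_one, mul_one, Real.norm_of_nonneg (sub_nonneg.2 ht1),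
        Real.norm_of_nonneg ht0.le]
      nlinarith [hy.1]
    · rw [e]
      exact starConvex_one_slitPlane hy.2 (sub_nonneg.2 ht1) ht0.le (by ring)

/-- The unit disc and the cut disc meet exactly in the lens, so T and h glue to a holomorphic
function on their union, which is star-shaped about 0. -/
theorem isThreeFTwoValue_of_eqOn_lens {a₁ a₂ a₃ b₁ b₂ : ℂ} {T h : ℂ → ℂ}
    (hT : HasUnitSeries (threeFTwoCoeff a₁ a₂ a₃ b₁ b₂) T) (hh : DifferentiableOn ℂ h cutDisc)
    (heq : ∀ z ∈ lens, T z = h z) {z : ℂ} (hz : z ∈ cutDisc) :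
    IsThreeFTwoValue a₁ a₂ a₃ b₁ b₂ z (h z) := by
  classical
  let F : ℂ → ℂ := fun w => if ‖w‖ < 1 then T w else h w
  have hF1 : EqOn F T (Metric.ball 0 1) := fun w hw => if_pos (mem_ball_zero_iff.1 hw)
  have hF2 : EqOn F h cutDisc := by
    intro w hw
    by_cases h1 : ‖w‖ < 1
    · exact (if_pos h1).trans (heq w (mem_lens.2 ⟨h1, hw.1⟩))
    · exact if_neg h1
  refine ⟨Metric.ball 0 1 ∪ cutDisc, F, Metric.isOpen_ball.union isOpen_cutDisc,
    starConvex_ball_union_cutDisc, Or.inr hz, ?_, ?_, hF2 hz⟩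
  · exact (hT.differentiableOn.congr hF1).union_of_isOpen (hh.congr hF2) Metric.isOpen_ball
      isOpen_cutDisc
  · filter_upwards [Metric.ball_mem_nhds (0 : ℂ) one_pos] with w hw
    rw [hF1 hw]
    exact hT w (mem_ball_zero_iff.1 hw)

/-! ### The ₃F₂ as a tail of the Gauss series. -/

theorem HasUnitSeries.exists_tail {u : ℕ → ℂ} {f : ℂ → ℂ} (hf : HasUnitSeries u f) (N : ℕ) :
    ∃ g : ℂ → ℂ, HasUnitSeries (fun k => u (k + N)) g ∧
      ∀ z : ℂ, ‖z‖ < 1 → f z = ∑ m ∈ Finset.range N, u m * z ^ m + z ^ N * g z := by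
  have hs : ∀ z : ℂ, ‖z‖ < 1 → Summable fun k => u (k + N) * z ^ k := by
    intro z hz
    rcases eq_or_ne z 0 with rfl | h0
    · exact summable_of_ne_finset_zero (s := {0}) fun k hk => by
        simp [Finset.mem_singleton.not.1 hk]
    · refine (((summable_nat_add_iff N).2 (hf z hz).summable).mul_right (z ^ N)⁻¹).congr fun k => ?_
      rw [pow_add]
      field_simp
  refine ⟨fun z => ∑' k, u (k + N) * z ^ k, fun z hz => (hs z hz).hasSum, fun z hz => ?_⟩
  rw [← (hf z hz).tsum_eq, ← (hf z hz).summable.sum_add_tsum_nat_add N, ← tsum_mul_left]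
  congr 1
  refine tsum_congr fun k => ?_
  ring

theorem ascPochhammer_add_eval (x : ℂ) (N k : ℕ) :
    (ascPochhammer ℂ (N + k)).eval x
      = (ascPochhammer ℂ N).eval x * (ascPochhammer ℂ k).eval (x + N) := by
  rw [← ascPochhammer_mul]
  simp

theorem Gamma_add_natCast {x : ℂ} (hx : ∀ m : ℕ, x ≠ -m) (k : ℕ) :
    Gamma (x + k) = Gamma x * (ascPochhammer ℂ k).eval x := by
  rw [← Gamma_add_nat_div_Gamma_eq x hx, mul_div_cancel₀ _ (Gamma_ne_zero hx)]

/-- The parameters 1 and N + 1 shift the index: (1)ₖ/((N + 1)ₖ k!) = N!/(N + k)!. The other symbols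
split as (x)ₙ₊ₖ = (x)ₙ (x + n)ₖ with n = N. -/
theorem prefactor_mul_threeFTwoCoeff (N : ℕ) {β σ ν : ℂ} (hβ : ∀ m : ℕ, β - N ≠ -(m : ℂ))
    (hβσ : ∀ m : ℕ, β + σ ≠ -(m : ℂ)) (k : ℕ) :
    Gamma β * (ascPochhammer ℂ N).eval (ν - N) / (Gamma (β + σ) * (N.factorial : ℂ))
        * threeFTwoCoeff β ν 1 (β + σ) (N + 1) k
      = Gamma (β - N) * gaussCoeff (ν - N) (β - N) (β + σ - N) (k + N) := by
  have hβ' : ∀ m : ℕ, β ≠ -(m : ℂ) := fun m hm =>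
    hβ (m + N) (by push_cast; linear_combination hm)
  have e1 := Gamma_add_natCast hβ (k + N)
  have e2 := Gamma_add_natCast hβ' k
  have e3 := Gamma_add_natCast hβσ k
  have e4 := ascPochhammer_add_eval (ν - N) N k
  have e5 := ascPochhammer_add_eval 1 N k
  rw [show β - N + (k + N : ℕ) = β + k by push_cast; ring, e2] at e1
  rw [sub_add_cancel] at e4
  rw [ascPochhammer_eval_one, ascPochhammer_eval_one, add_comm (1 : ℂ)] at e5
  have f1 : ((N + k).factorial : ℂ) ≠ 0 := Nat.cast_ne_zero.2 (Nat.factorial_ne_zero _)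
  have f2 : (N.factorial : ℂ) ≠ 0 := Nat.cast_ne_zero.2 N.factorial_ne_zero
  have f3 : (k.factorial : ℂ) ≠ 0 := Nat.cast_ne_zero.2 k.factorial_ne_zero
  have f4 : (ascPochhammer ℂ k).eval ((N : ℂ) + 1) ≠ 0 := by
    intro h
    rw [h, mul_zero] at e5
    exact f1 e5
  have f5 : Gamma (β + σ) ≠ 0 := Gamma_ne_zero hβσ
  have f6 : (ascPochhammer ℂ k).eval (β + σ) ≠ 0 := by
    intro h
    rw [h, mul_zero] at e3
    exact Gamma_ne_zero (fun m hm => hβσ (m + k) (by push_cast; linear_combination hm)) e3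
  rw [threeFTwoCoeff, gaussCoeff, ascPochhammer_eval_one, add_comm k N, e4, e5,
    show β + σ - N + (N + k : ℕ) = β + σ + k by push_cast; ring, e3]
  rw [add_comm k N] at e1
  field_simp
  linear_combination (ascPochhammer ℂ N).eval (ν - N) * (ascPochhammer ℂ k).eval ν * e1

/-- Binomial expansion of z = (z - 1) + 1 and exchange of the two sums. -/
theorem sum_mul_pow_eq_sum_sub_one_pow (N : ℕ) (x : ℕ → ℂ) (z : ℂ) :
    ∑ l ∈ Finset.range N, (1 / (l.factorial : ℂ))
        * (∑ k ∈ Finset.Ico l N, x k / ((k - l).factorial : ℂ)) * (z - 1) ^ l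
      = ∑ k ∈ Finset.range N, x k / (k.factorial : ℂ) * z ^ k := by
  simp_rw [Finset.mul_sum, Finset.sum_mul, Finset.range_eq_Ico]
  rw [Finset.sum_Ico_Ico_comm]
  refine Finset.sum_congr rfl fun k _ => ?_
  rw [← Finset.range_eq_Ico]
  have h := add_pow (z - 1) 1 k
  rw [sub_add_cancel] at h
  rw [h, Finset.mul_sum]
  refine Finset.sum_congr rfl fun l hl => ?_
  have hlk : l ≤ k := Nat.lt_succ_iff.1 (Finset.mem_range.1 hl)
  rw [Nat.cast_choose ℂ hlk, one_pow]
  have f1 : (l.factorial : ℂ) ≠ 0 := Nat.cast_ne_zero.2 l.factorial_ne_zero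
  have f2 : (k.factorial : ℂ) ≠ 0 := Nat.cast_ne_zero.2 k.factorial_ne_zero
  have f3 : ((k - l).factorial : ℂ) ≠ 0 := Nat.cast_ne_zero.2 (Nat.factorial_ne_zero _)
  field_simp

theorem differentiableOn_reflect {u : ℕ → ℂ} {f : ℂ → ℂ} (hf : HasUnitSeries u f) :
    DifferentiableOn ℂ (fun z => f (1 - z)) cutDisc :=
  hf.differentiableOn.comp (by fun_prop) fun _ hz => mem_ball_zero_iff.2 hz.1

theorem differentiableOn_regularAtOne (a b c : ℂ) :
    DifferentiableOn ℂ (regularAtOne a b c) cutDisc :=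
  differentiableOn_reflect (hasUnitSeries_regularizedGaussHGFun a b (a + b + 1 - c))

theorem differentiableOn_singularAtOne (a b c : ℂ) :
    DifferentiableOn ℂ (singularAtOne a b c) cutDisc :=
  DifferentiableOn.mul
    (fun _ hz => (hasDerivAt_one_sub_cpow (c - a - b) hz.2).differentiableAt.differentiableWithinAt)
    (differentiableOn_reflect
      (hasUnitSeries_regularizedGaussHGFun (c - a) (c - b) (c - a - b + 1)))

theorem prefactor_mul_threeFTwo (N : ℕ) {β σ ν : ℂ} (hσν : ∀ m : ℤ, σ - ν ≠ m)
    (hβ : ∀ m : ℕ, β - N ≠ -(m : ℂ)) (hβσ : ∀ m : ℕ, β + σ ≠ -(m : ℂ)) {z : ℂ}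
    (hz : z ∈ cutDisc) :
    Gamma β * (ascPochhammer ℂ N).eval (ν - N) / (Gamma (β + σ) * (N.factorial : ℂ)) * z ^ N
        * threeFTwo β ν 1 (β + σ) (N + 1) z
      = Gamma (β - N)
          * (regularCoeff (ν - N) (β - N) (β + σ - N) * regularAtOne (ν - N) (β - N) (β + σ - N) z
            + singularCoeff (ν - N) (β - N) (β + σ - N)
              * singularAtOne (ν - N) (β - N) (β + σ - N) z)
        - ∑ m ∈ Finset.range N, Gamma (β - N) * gaussCoeff (ν - N) (β - N) (β + σ - N) m * z ^ m := by
  set a := ν - N with ha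
  set b := β - N with hb
  set c := β + σ - N with hc
  have hs : ∀ m : ℤ, c - a - b ≠ m := fun m hm =>
    hσν (m - N) (by push_cast; linear_combination hm)
  have hconn := regularizedGaussHGFun_connection hs
  have hcoeff : ∀ k, _ = Gamma b * gaussCoeff a b c (k + N) :=
    prefactor_mul_threeFTwoCoeff N (ν := ν) hβ hβσ
  rw [← ha] at hcoeff
  set C := Gamma β * (ascPochhammer ℂ N).eval a / (Gamma (β + σ) * (N.factorial : ℂ))
  obtain ⟨g, hg, hfg⟩ := (hasUnitSeries_regularizedGaussHGFun a b c).exists_tail N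
  set H : ℂ → ℂ := fun z => Gamma b * (regularCoeff a b c * regularAtOne a b c z
    + singularCoeff a b c * singularAtOne a b c z)
    - ∑ m ∈ Finset.range N, Gamma b * gaussCoeff a b c m * z ^ m with hH
  have hHd : DifferentiableOn ℂ H cutDisc := by
    refine DifferentiableOn.sub (DifferentiableOn.const_mul (DifferentiableOn.add
      ((differentiableOn_regularAtOne a b c).const_mul _)
      ((differentiableOn_singularAtOne a b c).const_mul _)) _) ?_
    fun_prop
  have hHl : ∀ z ∈ lens, H z = z ^ N * (Gamma b * g z) := by
    intro z hz
    have h1 := hfg z (mem_lens.1 hz).1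
    have h2 := hconn z hz
    simp only [hH]
    rw [← h2, h1, mul_add, Finset.mul_sum]
    simp_rw [mul_assoc]
    ring
  change C * z ^ N * threeFTwo β ν 1 (β + σ) (N + 1) z = H z
  -- C vanishes when ν is one of 1, …, N. Then division by C is impossible, but the whole tail is
  -- zero, and H vanishes on the cut disc by the identity theorem.
  rcases eq_or_ne C 0 with hC | hC
  · have hg0 : ∀ z : ℂ, ‖z‖ < 1 → Gamma b * g z = 0 := by
      intro z hz
      have h1 := (hg.const_mul (Gamma b)) z hz
      refine h1.unique ?_
      have : (fun m => Gamma b * gaussCoeff a b c (m + N) * z ^ m) = fun _ => 0 := by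
        funext m
        rw [← hcoeff m, hC, zero_mul, zero_mul]
      rw [this]
      exact hasSum_zero
    have hzero : EqOn H (fun _ => 0) cutDisc := by
      refine (hHd.analyticOnNhd isOpen_cutDisc).eqOn_of_preconnected_of_eventuallyEq
        analyticOnNhd_const isPreconnected_cutDisc (lens_subset_cutDisc half_mem_lens) ?_
      filter_upwards [isOpen_lens.mem_nhds half_mem_lens] with w hw
      rw [hHl w hw, hg0 w (mem_lens.1 hw).1, mul_zero]
    rw [hzero hz, hC, zero_mul, zero_mul]
  · have hT : HasUnitSeries (threeFTwoCoeff β ν 1 (β + σ) (N + 1))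
        (fun z => C⁻¹ * (Gamma b * g z)) := by
      intro z hz
      have h1 := ((hg.const_mul (Gamma b)).const_mul C⁻¹) z hz
      refine h1.congr_fun fun k => ?_
      beta_reduce
      rw [← hcoeff k, inv_mul_cancel_left₀ hC]
    have hval := isThreeFTwoValue_of_eqOn_lens (h := fun z => C⁻¹ * (H z / z ^ N)) hT
      ((hHd.div (by fun_prop) fun w hw => pow_ne_zero _ (ne_zero_of_mem_cutDisc hw)).const_mul _)
      (fun w hw => by
        have := pow_ne_zero N (ne_zero_of_mem_cutDisc (lens_subset_cutDisc hw))
        simp only [hHl w hw]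
        field_simp) hz
    rw [hval.threeFTwo_eq]
    have := pow_ne_zero N (ne_zero_of_mem_cutDisc hz)
    field_simp

end HypergeometricConnection

/-! ### Translation to the stated formula. -/

open HypergeometricConnection

theorem mainTheorem1 (n : ℕ) (hn : 1 ≤ n) (β σ ν : ℂ)
    (hσν : ∀ m : ℤ, σ - ν ≠ (m : ℂ))
    (hβ : ∀ m : ℕ, β - (n : ℂ) + 1 ≠ -(m : ℂ))
    (hβσ : ∀ m : ℕ, β + σ ≠ -(m : ℂ))
    (z : ℂ) (hz : ‖1 - z‖ < 1) (hz' : 1 - z ∈ Complex.slitPlane) :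
    Complex.Gamma β * (ascPochhammer ℂ (n - 1)).eval (ν - (n : ℂ) + 1)
        / (Complex.Gamma (β + σ) * ((n - 1).factorial : ℂ)) * z ^ (n - 1)
        * threeFTwo β ν 1 (β + σ) (n : ℂ) z
      = (-1) ^ n * ((Real.pi : ℂ) / Complex.sin ((Real.pi : ℂ) * (σ - ν)))
          / (Complex.Gamma (1 + ν - (n : ℂ)) * Complex.Gamma (σ - ν + (n : ℂ)))
          * (1 - z) ^ (σ + (n : ℂ) - ν - 1)
          * ordinaryHypergeometric σ (β + σ - ν) (σ - ν + (n : ℂ)) (1 - z)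
        - (-1) ^ n * ((Real.pi : ℂ) / Complex.sin ((Real.pi : ℂ) * (σ - ν)))
          * Complex.Gamma (β - (n : ℂ) + 1)
          / (Complex.Gamma σ * Complex.Gamma (β + σ - ν) * Complex.Gamma (2 - (n : ℂ) - σ + ν))
          * ordinaryHypergeometric (1 + ν - (n : ℂ)) (β - (n : ℂ) + 1) (2 - (n : ℂ) - σ + ν) (1 - z)
        - ∑ l ∈ Finset.range (n - 1), (1 / (l.factorial : ℂ))
          * (∑ k ∈ Finset.Ico l (n - 1),
              (ascPochhammer ℂ k).eval (ν - (n : ℂ) + 1) * Complex.Gamma ((k : ℂ) - (n : ℂ) + β + 1)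
                / (Complex.Gamma ((k : ℂ) - (n : ℂ) + β + σ + 1) * ((k - l).factorial : ℂ)))
          * (z - 1) ^ l := by
  obtain ⟨N, rfl⟩ : ∃ N, n = N + 1 := ⟨n - 1, by omega⟩
  have hβ' : ∀ m : ℕ, β - N ≠ -(m : ℂ) := fun m hm =>
    hβ m (by push_cast; linear_combination hm)
  have key := prefactor_mul_threeFTwo N hσν hβ' hβσ (z := z) ⟨hz, hz'⟩
  have ea : ν - ((N + 1 : ℕ) : ℂ) + 1 = ν - N := by push_cast; ring
  have eb : β - ((N + 1 : ℕ) : ℂ) + 1 = β - N := by push_cast; ring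
  have en : ((N + 1 : ℕ) : ℂ) = N + 1 := by push_cast; ring
  have ea' : 1 + ν - ((N + 1 : ℕ) : ℂ) = ν - N := by push_cast; ring
  have es : σ - ν + ((N + 1 : ℕ) : ℂ) = β + σ - N - (ν - N) - (β - N) + 1 := by push_cast; ring
  have es' : σ + ((N + 1 : ℕ) : ℂ) - ν - 1 = β + σ - N - (ν - N) - (β - N) := by push_cast; ring
  have er : 2 - ((N + 1 : ℕ) : ℂ) - σ + ν = ν - N + (β - N) + 1 - (β + σ - N) := by push_cast; ring
  have eA : β + σ - N - (ν - N) = β + σ - ν := by ring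
  have eB : β + σ - N - (β - N) = σ := by ring
  -- Neither lower parameter at 1 is a nonpositive integer, so the regularized functions are the
  -- ordinary ones divided by Γ.
  have h1 : ∀ k : ℕ, β + σ - N - (ν - N) - (β - N) + 1 ≠ -k := fun k hk =>
    hσν (-k - N - 1) (by push_cast; linear_combination hk)
  have h2 : ∀ k : ℕ, ν - N + (β - N) + 1 - (β + σ - N) ≠ -k := fun k hk =>
    hσν (k + 1 - N) (by push_cast; linear_combination -hk)
  have hsum : ∑ l ∈ Finset.range N, (1 / (l.factorial : ℂ))
      * (∑ k ∈ Finset.Ico l N, (ascPochhammer ℂ k).eval (ν - N)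
          * Complex.Gamma ((k : ℂ) - ((N + 1 : ℕ) : ℂ) + β + 1)
          / (Complex.Gamma ((k : ℂ) - ((N + 1 : ℕ) : ℂ) + β + σ + 1) * ((k - l).factorial : ℂ)))
      * (z - 1) ^ l
      = ∑ m ∈ Finset.range N,
          Complex.Gamma (β - N) * gaussCoeff (ν - N) (β - N) (β + σ - N) m * z ^ m := by
    simp_rw [← div_div]
    rw [sum_mul_pow_eq_sum_sub_one_pow N (fun k => (ascPochhammer ℂ k).eval (ν - N)
      * Complex.Gamma ((k : ℂ) - ((N + 1 : ℕ) : ℂ) + β + 1)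
      / Complex.Gamma ((k : ℂ) - ((N + 1 : ℕ) : ℂ) + β + σ + 1))]
    refine Finset.sum_congr rfl fun k _ => ?_
    rw [show (k : ℂ) - ((N + 1 : ℕ) : ℂ) + β + 1 = β - N + k by push_cast; ring,
      show (k : ℂ) - ((N + 1 : ℕ) : ℂ) + β + σ + 1 = β + σ - N + k by push_cast; ring,
      Gamma_add_natCast hβ', gaussCoeff]
    ring
  -- The shift of σ - ν by N gives (-1)^N; the formula has (-1)^n = -(-1)^N, whence the signs of the
  -- two terms.
  have hsin : Complex.sin ((Real.pi : ℂ) * (β + σ - N - (ν - N) - (β - N)))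
      = (-1) ^ N * Complex.sin ((Real.pi : ℂ) * (σ - ν)) := by
    rw [show (Real.pi : ℂ) * (β + σ - N - (ν - N) - (β - N))
      = (Real.pi : ℂ) * (σ - ν) + N * Real.pi by ring, Complex.sin_antiperiodic.add_nat_mul_eq]
  have hpow : ((-1 : ℂ) ^ N)⁻¹ = (-1) ^ N := by
    rw [← inv_pow, inv_neg_one]
  rw [Nat.add_sub_cancel, ea, eb, ea', es, es', er, hsum, en, key]
  have g1 := Complex.ordinaryHypergeometric_div_Gamma_eq (a := σ) (b := β + σ - ν) (z := 1 - z) h1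
  have g2 := Complex.ordinaryHypergeometric_div_Gamma_eq (a := ν - N) (b := β - N) (z := 1 - z) h2
  -- The singular solution carries the upper parameters as c - a = β + σ - ν, c - b = σ, in the
  -- opposite order.
  rw [Complex.regularizedGaussHGFun_symm] at g1
  simp only [regularCoeff, singularCoeff, regularAtOne, singularAtOne]
  rw [hsin, ← g2]
  simp only [eA, eB]
  rw [eA] at g1
  rw [← g1, div_mul_eq_div_div, ← hpow]
  have hG := Complex.Gamma_ne_zero hβ'
  field_simp
  ring
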